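/- Let $d \ge 3$ be an integer, let $\beta_c(d)$ be the real number with $(d-1)\tanh \beta_c(d) = 1$, and let $0 < \beta < \beta_c(d)$. The Swendsen–Wang dynamics for the ferromagnetic Ising model on a finite simple graph $G=(V,E)$ at inverse temperature $\beta$ is the Markov chain on $\{+,-\}^V$ in which one step from $\sigma$ is made as follows: let $E(\sigma)$ be the set of edges of $G$ whose two ends have the same spin in $\sigma$; delete every edge of $E(\sigma)$ independently with probability $e^{-2\beta}$, and let $F$ be the set of remaining edges of $E(\sigma)$; then give every connected component of $(V,F)$ an independent uniformly random spin from $\{+,-\}$, which is assigned to all vertices of that component. Let $P$ be its transition matrix, with eigenvalues $\lambda_1 = 1, \lambda_2, \dots, \lambda_{2^{|V|}}$ listed with multiplicity. The absolute spectral gap of $P$ is $1-\max_{i\ge 2}|\lambda_i|$, and the relaxation time $T_{\mathrm{rel}}(G,\beta)$ is the inverse of the absolute spectral gap. Then $T_{\mathrm{rel}}(G,\beta) = \Theta(1)$, uniformly over all graphs of maximum degree at most $d$: there are constants $c, C > 0$ that depend only on $d$ and $\beta$ such that for every $n \ge 1$ and every $n$-vertex graph $G$ of maximum degree at most $d$,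 the absolute spectral gap is positive and $c \le T_{\mathrm{rel}}(G,\beta) \le C$. -/

import Mathlib

/-- Ising configurations on the vertex set `V`; the spins `+` and `-` are the units `1` and `-1`. -/
abbrev IsingConfig (V : Type*) : Type _ := V → ℤˣ

open scoped Classical in
/-- The set `E(σ)` of agreeing edges of `G`: those with the same spin at both ends. -/
noncomputable def agreeingEdges {V : Type*} [Fintype V] (G : SimpleGraph V)
    (σ : IsingConfig V) : Finset (Sym2 V) :=
  {e ∈ G.edgeFinset | ∀ v ∈ e, ∀ w ∈ e, σ v = σ w}

/-- The probability that the percolation step started from `σ` keeps exactly the edges in `F`,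
for `F ⊆ E(σ)`: every edge of `E(σ)` is independently deleted with probability `exp (-2β)` and
kept with probability `1 - exp (-2β)`. -/
noncomputable def percolationProb {V : Type*} [Fintype V] (G : SimpleGraph V) (β : ℝ)
    (σ : IsingConfig V) (F : Finset (Sym2 V)) : ℝ :=
  (1 - Real.exp (-2 * β)) ^ F.card *
    Real.exp (-2 * β) ^ ((agreeingEdges G σ).card - F.card)

open scoped Classical in
/-- The probability that the recolouring step produces `τ` from the edge set `F`: every connected
component `C` of `(V, F)` receives an independent uniform spin `s C`, given to all its vertices. -/
noncomputable def recolorProb {V : Type*} [Fintype V] (F : Finset (Sym2 V))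
    (τ : IsingConfig V) : ℝ :=
  ∑ s : (SimpleGraph.fromEdgeSet (F : Set (Sym2 V))).ConnectedComponent → ℤˣ,
    if ∀ v, τ v = s ((SimpleGraph.fromEdgeSet (F : Set (Sym2 V))).connectedComponentMk v)
    then (1 / 2 : ℝ) ^
      Fintype.card (SimpleGraph.fromEdgeSet (F : Set (Sym2 V))).ConnectedComponent
    else 0

/-- The transition matrix of the Swendsen-Wang dynamics for the ferromagnetic Ising model on `G`
at inverse temperature `β`. -/
noncomputable def swendsenWang {V : Type*} [Fintype V] (G : SimpleGraph V) (β : ℝ) :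
    Matrix (IsingConfig V) (IsingConfig V) ℝ :=
  Matrix.of fun σ τ =>
    ∑ F ∈ (agreeingEdges G σ).powerset, percolationProb G β σ F * recolorProb F τ

/-- The eigenvalues of a real square matrix, in `ℂ`, with algebraic multiplicity. -/
noncomputable def eigenvalueMultiset {Ω : Type*} [Fintype Ω] [DecidableEq Ω]
    (P : Matrix Ω Ω ℝ) : Multiset ℂ :=
  (P.map (algebraMap ℝ ℂ)).charpoly.roots

/-- The largest modulus `λ*` of an eigenvalue of the stochastic matrix `P` other than the
trivial eigenvalue `1`, of which just one copy is removed. -/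
noncomputable def secondEigenvalueModulus {Ω : Type*} [Fintype Ω] [DecidableEq Ω]
    (P : Matrix Ω Ω ℝ) : ℝ :=
  sSup {r : ℝ | ∃ z ∈ (eigenvalueMultiset P).erase 1, r = ‖z‖}

/-- The absolute spectral gap `1 - λ*`. -/
noncomputable def absSpectralGap {Ω : Type*} [Fintype Ω] [DecidableEq Ω]
    (P : Matrix Ω Ω ℝ) : ℝ :=
  1 - secondEigenvalueModulus P

/-- The relaxation time, the inverse of the absolute spectral gap. -/
noncomputable def relaxationTime {Ω : Type*} [Fintype Ω] [DecidableEq Ω]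
    (P : Matrix Ω Ω ℝ) : ℝ :=
  (absSpectralGap P)⁻¹

set_option linter.unusedSectionVars false

/-! By the Edwards–Sokal identity (`isingWeight_mul_percolationKernel`), the joint weight of a
configuration and a kept edge set `F` is a factor depending on `F` times the indicator that the
configuration is constant along `F`. So one Swendsen–Wang step draws `F` and then resamples from the
conditional law given `F`. Its quadratic form is therefore a nonnegative combination of squares,
which rules out negative eigenvalues, and its Dirichlet form at `f` is the mean conditional variance
of `f` given `F` (`percolationVariance`). The upper bound on the relaxation time thus reduces to `E
Var(f | F) ≥ c Var f`; the lower bound only uses that the second eigenvalue modulus is nonnegative.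

This inequality is proved for every external field, by lowering the coupling of the measure from `β`
to `0` while the percolation kernel stays at `β`. Observing a weak signal of the spins on each edge
splits the Ising measure into a mixture of Ising measures with coupling smaller by `δ` and with new
fields (`exists_isingWeight_mul_prod_eq`). The mean conditional variance does not increase when the
measure is split in this way (`sum_percolationVariance_le`), whereas the mean variance loses at most
a factor `1 - L δ` (`exists_mixture_weaker_coupling`). The rate `L` depends on neither graph nor
field because the covariances of one spin with all others are summable (`sum_abs_covariance_le`):
removing vertices one at a time bounds influences as on a tree, by a geometric series of ratio
`(maximum degree - 1) * tanh β < 1`. The whole descent costs `exp (-2 L β)`.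

At coupling `0` the spins are independent. If percolation on all edges keeps `η`, the observation
ignores the spins at vertices isolated in `η`. For independent spins, the mean conditional variance
dominates an additive function of the set of ignored vertices, whose total is `Var f`
(`exists_conditional_variance_minorant`). Since each vertex is isolated with probability at least
`exp (-2β)` to the power of the degree bound, that fraction of the variance survives. -/

/-- The variance of `f` under the unnormalised weight `w`, multiplied by the total weight. -/
noncomputable def weightedVariance {Ω : Type*} [Fintype Ω] (w f : Ω → ℝ) : ℝ :=
  ∑ x, w x * f x ^ 2 - (∑ x, w x * f x) ^ 2 / ∑ x, w x

/-! ### Variances under unnormalised weights -/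

section WeightedVariance

variable {Ω : Type*} [Fintype Ω]

theorem sum_mul_sub_sq (w f : Ω → ℝ) (c : ℝ) :
    ∑ x, w x * (f x - c) ^ 2 =
      ∑ x, w x * f x ^ 2 - 2 * c * ∑ x, w x * f x + c ^ 2 * ∑ x, w x := by
  rw [Finset.mul_sum, Finset.mul_sum, ← Finset.sum_sub_distrib, ← Finset.sum_add_distrib]
  exact Finset.sum_congr rfl fun x _ => by ring

theorem weightedVariance_eq_sum (w f : Ω → ℝ) :
    weightedVariance w f = ∑ x, w x * (f x - (∑ y, w y * f y) / ∑ y, w y) ^ 2 := by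
  rw [sum_mul_sub_sq, weightedVariance]
  -- A zero total weight makes the quotient `0` by convention, so observations that no configuration
  -- yields need no separate treatment later.
  rcases eq_or_ne (∑ y, w y) 0 with h | h
  · simp [h]
  · field_simp
    ring

/-- The mean is the minimiser: the excess is `(c * Z - ∑ w f) ^ 2 / Z`, with `Z` the total weight.
-/
theorem weightedVariance_le_sum {w : Ω → ℝ} (hw : ∀ x, 0 ≤ w x) (f : Ω → ℝ) (c : ℝ) :
    weightedVariance w f ≤ ∑ x, w x * (f x - c) ^ 2 := by
  rw [sum_mul_sub_sq, weightedVariance]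
  rcases eq_or_ne (∑ y, w y) 0 with h | h
  · have h0 : ∀ x, w x = 0 := by
      simpa using (Finset.sum_eq_zero_iff_of_nonneg fun x _ => hw x).1 h
    simp [h0]
  · have hpos : 0 < ∑ y, w y := lt_of_le_of_ne (Finset.sum_nonneg fun x _ => hw x) h.symm
    have key : (∑ x, w x * f x ^ 2 - 2 * c * ∑ x, w x * f x + c ^ 2 * ∑ x, w x) -
        (∑ x, w x * f x ^ 2 - (∑ x, w x * f x) ^ 2 / ∑ x, w x) =
        (c * ∑ x, w x - ∑ x, w x * f x) ^ 2 / ∑ x, w x := by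
      field_simp
      ring
    have := div_nonneg (sq_nonneg (c * ∑ x, w x - ∑ x, w x * f x)) hpos.le
    linarith

theorem weightedVariance_nonneg {w : Ω → ℝ} (hw : ∀ x, 0 ≤ w x) (f : Ω → ℝ) :
    0 ≤ weightedVariance w f := by
  rw [weightedVariance_eq_sum]
  exact Finset.sum_nonneg fun x _ => mul_nonneg (hw x) (sq_nonneg _)

theorem weightedVariance_smul (c : ℝ) (w f : Ω → ℝ) :
    weightedVariance (fun x => c * w x) f = c * weightedVariance w f := by
  simp only [weightedVariance, mul_assoc, ← Finset.mul_sum]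
  rcases eq_or_ne c 0 with h | h
  · simp [h]
  · rw [mul_pow, mul_sub, pow_two c, mul_assoc, mul_div_mul_left _ _ h, mul_div_assoc]

/-- Conditioning does not increase the variance: the weighted variance is superadditive. -/
theorem sum_weightedVariance_le {ι : Type*} (s : Finset ι) {w : ι → Ω → ℝ}
    (hw : ∀ i ∈ s, ∀ x, 0 ≤ w i x) (f : Ω → ℝ) :
    ∑ i ∈ s, weightedVariance (w i) f ≤ weightedVariance (fun x => ∑ i ∈ s, w i x) f := by
  -- The mean under the total weight serves as a common, suboptimal centre for every `w i`.
  rw [weightedVariance_eq_sum (fun x => ∑ i ∈ s, w i x)]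
  simp only [Finset.sum_mul]
  rw [Finset.sum_comm]
  exact Finset.sum_le_sum fun i hi => by
    simpa only [Finset.sum_mul] using weightedVariance_le_sum (hw i hi) f _

theorem weightedVariance_sub_const {w : Ω → ℝ} (hw : ∑ x, w x ≠ 0) (f : Ω → ℝ) (c : ℝ) :
    weightedVariance w (fun x => f x - c) = weightedVariance w f := by
  have h : ∑ x, w x * (f x - c) = ∑ x, w x * f x - c * ∑ x, w x := by
    rw [Finset.mul_sum, ← Finset.sum_sub_distrib]
    exact Finset.sum_congr rfl fun x _ => by ring
  rw [weightedVariance, weightedVariance, sum_mul_sub_sq, h]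
  field_simp
  ring

end WeightedVariance

/-! ### Ising weights and conditioning on one spin -/

/-- The spin value of a unit of `ℤ`, as a real number. -/
def spin (x : ℤˣ) : ℝ := ((x : ℤ) : ℝ)

@[simp] theorem spin_one : spin 1 = 1 := by simp [spin]

@[simp] theorem spin_neg_one : spin (-1) = -1 := by simp [spin]

theorem spin_mul_self (x : ℤˣ) : spin x * spin x = 1 := by
  rcases Int.units_eq_one_or x with rfl | rfl <;> simp

theorem sum_units (f : ℤˣ → ℝ) : ∑ x, f x = f 1 + f (-1) := by
  rw [UnitsInt.univ, Finset.sum_pair (by decide)]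

/-- Flipping the spin at `v` is an involution, and each pair of flipped configurations is met twice
on the right. -/
theorem sum_config_update {V : Type*} [Fintype V] [DecidableEq V] (v : V)
    (F : IsingConfig V → ℝ) :
    ∑ σ, F σ = 2⁻¹ * ∑ σ : IsingConfig V,
      (F (Function.update σ v 1) + F (Function.update σ v (-1))) := by
  have h1 : ∑ σ : IsingConfig V, F (Function.update σ v (-σ v)) = ∑ σ, F σ := by
    refine Fintype.sum_bijective (fun σ : IsingConfig V => Function.update σ v (-σ v)) ?_ _ _
      fun σ => rfl
    exact Function.Involutive.bijective fun σ => by simp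
  have h2 : ∀ σ : IsingConfig V, F σ + F (Function.update σ v (-σ v)) =
      F (Function.update σ v 1) + F (Function.update σ v (-1)) := by
    intro σ
    rcases Int.units_eq_one_or (σ v) with h | h
    · nth_rewrite 1 [← Function.update_eq_self v σ]
      rw [h]
    · nth_rewrite 1 [← Function.update_eq_self v σ]
      rw [h, neg_neg, add_comm]
  rw [← Finset.sum_congr rfl fun σ _ => h2 σ, Finset.sum_add_distrib, h1]
  ring

/-- The weight of `σ` in the Ising model on the subgraph of `G` induced by `T`, with coupling `b`
and external field `h`. -/
noncomputable def isingWeight {V : Type*} (G : SimpleGraph V) [DecidableRel G.Adj]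
    (T : Finset V) (b : ℝ) (h : V → ℝ) (σ : IsingConfig V) : ℝ :=
  Real.exp (b / 2 * ∑ u ∈ T, ∑ v ∈ T, (if G.Adj u v then spin (σ u) * spin (σ v) else 0) +
    ∑ v ∈ T, h v * spin (σ v))

/-- The mean spin at `u` in the Ising model on the subgraph induced by `T`. -/
noncomputable def magnetization {V : Type*} [Fintype V] [DecidableEq V] (G : SimpleGraph V)
    [DecidableRel G.Adj] (T : Finset V) (b : ℝ) (h : V → ℝ) (u : V) : ℝ :=
  (∑ σ, isingWeight G T b h σ * spin (σ u)) / ∑ σ, isingWeight G T b h σ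

section Influence

variable {V : Type*} (G : SimpleGraph V) [DecidableRel G.Adj]

theorem isingWeight_pos (T : Finset V) (b : ℝ) (h : V → ℝ) (σ : IsingConfig V) :
    0 < isingWeight G T b h σ := Real.exp_pos _

theorem isingWeight_congr {T : Finset V} (b : ℝ) {h h' : V → ℝ} (hh : ∀ v ∈ T, h v = h' v)
    (σ : IsingConfig V) : isingWeight G T b h σ = isingWeight G T b h' σ := by
  unfold isingWeight
  congr 2
  exact Finset.sum_congr rfl fun v hv => by rw [hh v hv]

variable [DecidableEq V]

/-- A frozen spin acts on its neighbours as an external field. Allowing arbitrary fields therefore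
makes the class of models closed under vertex removal. -/
theorem isingWeight_update {T : Finset V} {w : V} (hw : w ∈ T) (b : ℝ) (h : V → ℝ)
    (σ : IsingConfig V) (x : ℤˣ) :
    isingWeight G T b h (Function.update σ w x) = Real.exp (h w * spin x) *
      isingWeight G (T.erase w) b
        (fun v => h v + if G.Adj w v then b * spin x else 0) σ := by
  unfold isingWeight
  rw [← Real.exp_add]
  congr 1
  have hne : ∀ v ∈ T.erase w, Function.update σ w x v = σ v := fun v hv =>
    Function.update_of_ne (Finset.ne_of_mem_erase hv) _ _
  have e1 : ∀ g : V → ℝ, ∑ v ∈ T, g v = g w + ∑ v ∈ T.erase w, g v := fun g =>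
    (Finset.add_sum_erase T g hw).symm
  rw [e1, e1, e1]
  have e2 : ∑ u ∈ T.erase w, ∑ v ∈ T, (if G.Adj u v then
      spin (Function.update σ w x u) * spin (Function.update σ w x v) else 0) =
      ∑ u ∈ T.erase w, (if G.Adj w u then spin (σ u) * spin x else 0) +
      ∑ u ∈ T.erase w, ∑ v ∈ T.erase w, (if G.Adj u v then spin (σ u) * spin (σ v) else 0) := by
    rw [← Finset.sum_add_distrib]
    refine Finset.sum_congr rfl fun u hu => ?_
    rw [e1]
    simp only [hne u hu, Function.update_self, G.adj_comm u w]
    congr 1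
    exact Finset.sum_congr rfl fun v hv => by rw [hne v hv]
  have e3 : ∑ v ∈ T.erase w, (if G.Adj w v then
      spin (Function.update σ w x w) * spin (Function.update σ w x v) else 0) =
      ∑ u ∈ T.erase w, (if G.Adj w u then spin (σ u) * spin x else 0) :=
    Finset.sum_congr rfl fun v hv => by rw [hne v hv, Function.update_self, mul_comm]
  have e4 : ∑ v ∈ T.erase w, h v * spin (Function.update σ w x v) =
      ∑ v ∈ T.erase w, h v * spin (σ v) :=
    Finset.sum_congr rfl fun v hv => by rw [hne v hv]
  have e5 : ∑ v ∈ T.erase w, (h v + if G.Adj w v then b * spin x else 0) * spin (σ v) =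
      ∑ v ∈ T.erase w, h v * spin (σ v) +
        b * ∑ u ∈ T.erase w, (if G.Adj w u then spin (σ u) * spin x else 0) := by
    rw [Finset.mul_sum, ← Finset.sum_add_distrib]
    refine Finset.sum_congr rfl fun v _ => ?_
    split_ifs <;> ring
  rw [e2, e3, e4, e5]
  simp only [SimpleGraph.irrefl, if_false, Function.update_self]
  ring

variable [Fintype V]

theorem partition_pos (T : Finset V) (b : ℝ) (h : V → ℝ) :
    0 < ∑ σ, isingWeight G T b h σ :=
  Finset.sum_pos (fun σ _ => isingWeight_pos G T b h σ) Finset.univ_nonempty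

theorem magnetization_congr {T : Finset V} (b : ℝ) {h h' : V → ℝ} (hh : ∀ v ∈ T, h v = h' v)
    (u : V) : magnetization G T b h u = magnetization G T b h' u := by
  simp only [magnetization, isingWeight_congr G b hh]

/-- Summation over the spin at `w`, with the field produced by `w` on the other vertices. -/
theorem sum_isingWeight_mul {T : Finset V} {w : V} (hw : w ∈ T) (b : ℝ) (h : V → ℝ)
    (F : IsingConfig V → ℝ) :
    ∑ σ, isingWeight G T b h σ * F σ = 2⁻¹ *
      (Real.exp (h w) * ∑ σ, isingWeight G (T.erase w) b
          (fun v => h v + if G.Adj w v then b else 0) σ * F (Function.update σ w 1) +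
        Real.exp (-h w) * ∑ σ, isingWeight G (T.erase w) b
          (fun v => h v + if G.Adj w v then -b else 0) σ * F (Function.update σ w (-1))) := by
  rw [sum_config_update w, Finset.sum_add_distrib, Finset.mul_sum, Finset.mul_sum]
  simp only [isingWeight_update G hw, spin_one, spin_neg_one, mul_one, mul_neg, mul_assoc]

/-- The two-point data at a vertex `w`: the conditional magnetizations given the spin at `w`, and
the weights of the two spins up to the factor given by the field at `w`. -/
theorem exists_conditional {T : Finset V} {w : V} (hw : w ∈ T) (b : ℝ) (h : V → ℝ) :
    ∃ P M : ℝ, 0 < P ∧ 0 < M ∧ ∀ y : ℝ,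
      let A := Real.exp y * P
      let B := Real.exp (-y) * M
      let mp := magnetization G (T.erase w) b (fun v => h v + if G.Adj w v then b else 0)
      let mm := magnetization G (T.erase w) b (fun v => h v + if G.Adj w v then -b else 0)
      let h' := Function.update h w y
      ∑ σ, isingWeight G T b h' σ = 2⁻¹ * (A + B) ∧
      ∑ σ, isingWeight G T b h' σ * spin (σ w) = 2⁻¹ * (A - B) ∧
      ∀ u, u ≠ w →
        ∑ σ, isingWeight G T b h' σ * spin (σ u) = 2⁻¹ * (A * mp u + B * mm u) ∧
        ∑ σ, isingWeight G T b h' σ * (spin (σ w) * spin (σ u)) =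
          2⁻¹ * (A * mp u - B * mm u) := by
  -- `P` and `M` are the partition functions without `w`, its neighbours feeling the field of a plus
  -- or minus spin. They do not involve the field `y` at `w`, so one pair serves several values of
  -- `y`.
  refine ⟨_, _, partition_pos G (T.erase w) b (fun v => h v + if G.Adj w v then b else 0),
    partition_pos G (T.erase w) b (fun v => h v + if G.Adj w v then -b else 0), fun y => ?_⟩
  have hc : ∀ c : ℝ, ∀ σ, isingWeight G (T.erase w) b
      (fun v => Function.update h w y v + if G.Adj w v then c else 0) σ =
      isingWeight G (T.erase w) b (fun v => h v + if G.Adj w v then c else 0) σ := by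
    intro c σ
    refine isingWeight_congr G b (fun v hv => ?_) σ
    rw [Function.update_of_ne (Finset.ne_of_mem_erase hv)]
  have key := sum_isingWeight_mul G hw b (Function.update h w y)
  simp only [hc, Function.update_self] at key
  have hP := (partition_pos G (T.erase w) b (fun v => h v + if G.Adj w v then b else 0)).ne'
  have hM := (partition_pos G (T.erase w) b (fun v => h v + if G.Adj w v then -b else 0)).ne'
  dsimp only
  refine ⟨?_, ?_, fun u hu => ⟨?_, ?_⟩⟩
  · have := key fun _ => 1
    simpa using this
  · have := key fun σ => spin (σ w)
    simp only [Function.update_self, spin_one, spin_neg_one, mul_one, mul_neg,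
      Finset.sum_neg_distrib] at this
    rw [this]
    ring
  · rw [key fun σ => spin (σ u)]
    simp only [Function.update_of_ne hu, magnetization]
    field_simp
  · rw [key fun σ => spin (σ w) * spin (σ u)]
    simp only [Function.update_of_ne hu, Function.update_self, magnetization, spin_one,
      spin_neg_one, one_mul, neg_one_mul, mul_neg, Finset.sum_neg_distrib]
    field_simp
    ring

end Influence

/-! ### The influence of one spin on another -/

theorem tanh_eq_exp (b : ℝ) :
    Real.tanh b = (Real.exp b - Real.exp (-b)) / (Real.exp b + Real.exp (-b)) := by
  rw [Real.tanh_eq_sinh_div_cosh, Real.sinh_eq, Real.cosh_eq]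
  field_simp

theorem tanh_strictMono : StrictMono Real.tanh := by
  intro x y hxy
  rw [tanh_eq_exp, tanh_eq_exp, div_lt_div_iff₀ (by positivity) (by positivity)]
  have h1 : Real.exp (-y) < Real.exp (-x) := Real.exp_lt_exp.2 (by linarith)
  have h2 : Real.exp x < Real.exp y := Real.exp_lt_exp.2 hxy
  have h3 := mul_lt_mul'' h2 h1 (Real.exp_pos _).le (Real.exp_pos _).le
  nlinarith

/-- Shifting the field at a single spin by `±b` changes its mean by at most `2 tanh b`. -/
theorem abs_two_state_mean_sub_le {A B b : ℝ} (hA : 0 < A) (hB : 0 < B) (hb : 0 ≤ b) :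
    |(A * Real.exp b - B * Real.exp (-b)) / (A * Real.exp b + B * Real.exp (-b)) -
      (A * Real.exp (-b) - B * Real.exp b) / (A * Real.exp (-b) + B * Real.exp b)| ≤
      2 * Real.tanh b := by
  rw [tanh_eq_exp]
  have hxy : Real.exp b * Real.exp (-b) = 1 := by rw [← Real.exp_add]; simp
  have hyx : Real.exp (-b) ≤ Real.exp b := Real.exp_le_exp.2 (by linarith)
  have hx := Real.exp_pos b
  have hy := Real.exp_pos (-b)
  generalize Real.exp b = x at *
  generalize Real.exp (-b) = y at *
  have e : (A * x - B * y) / (A * x + B * y) - (A * y - B * x) / (A * y + B * x) =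
      2 * (A * B) * (x ^ 2 - y ^ 2) / ((A * x + B * y) * (A * y + B * x)) := by
    field_simp
    ring
  have hxy2 : 0 ≤ x ^ 2 - y ^ 2 := by nlinarith
  rw [e, abs_of_nonneg (by positivity), ← mul_div_assoc, div_le_div_iff₀ (by positivity)
    (by positivity)]
  have h0 : 0 ≤ (x - y) * (x * y) * (A - B) ^ 2 := by
    have : 0 ≤ x - y := by linarith
    positivity
  nlinarith

/-- A bound on the effect of changing the arguments in `N` one at a time. -/
theorem sum_abs_sub_le_card_mul {V : Type*} [DecidableEq V] (S N : Finset V)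
    (Φ : (V → ℝ) → V → ℝ) (b M : ℝ)
    (hM : ∀ h : V → ℝ, ∀ w ∈ N, ∑ u ∈ S, |Φ (h + Pi.single w b) u - Φ (h - Pi.single w b) u| ≤ M)
    (h : V → ℝ) :
    ∑ u ∈ S, |Φ (h + ∑ w ∈ N, Pi.single w b) u - Φ (h - ∑ w ∈ N, Pi.single w b) u| ≤
      N.card * M := by
  induction N using Finset.induction_on generalizing h with
  | empty => simp
  | insert a N ha ih =>
    rw [Finset.sum_insert ha, Finset.card_insert_of_notMem ha]
    have h1 := ih (fun h w hw => hM h w (Finset.mem_insert_of_mem hw)) (h + Pi.single a b)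
    have h2 := hM (h - ∑ w ∈ N, Pi.single w b) a (Finset.mem_insert_self a N)
    rw [add_assoc] at h1
    rw [sub_sub, add_comm (∑ w ∈ N, Pi.single w b)] at h2
    have h3 : h - ∑ w ∈ N, Pi.single w b + Pi.single a b =
      h + Pi.single a b - ∑ w ∈ N, Pi.single w b := by abel
    rw [h3] at h2
    have h4 := add_le_add h1 h2
    rw [← Finset.sum_add_distrib] at h4
    push_cast
    rw [add_mul, one_mul]
    exact (Finset.sum_le_sum fun u _ => abs_sub_le _ _ _).trans h4

/-! ### Total influence, the tree recursion and summable covariances -/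

section Covariance

variable {V : Type*} [Fintype V] [DecidableEq V] (G : SimpleGraph V) [DecidableRel G.Adj]

/-- The total influence of the spin at `w` is bounded by the total influences of the neighbours
of `w` in the graph without `w`. -/
theorem sum_conditional_sub_le {T : Finset V} {w : V} (b M : ℝ) (n : ℕ) (hM0 : 0 ≤ M)
    (hn : ((T.erase w).filter fun v => G.Adj w v).card ≤ n)
    (hM : ∀ h : V → ℝ, ∀ v ∈ T.erase w, G.Adj w v → ∑ u ∈ T.erase w,
      |magnetization G (T.erase w) b (h + Pi.single v b) u -
        magnetization G (T.erase w) b (h - Pi.single v b) u| ≤ M) (h : V → ℝ) :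
    ∑ u ∈ T.erase w,
      |magnetization G (T.erase w) b (fun v => h v + if G.Adj w v then b else 0) u -
        magnetization G (T.erase w) b (fun v => h v + if G.Adj w v then -b else 0) u| ≤ n * M := by
  have key := sum_abs_sub_le_card_mul (T.erase w) ((T.erase w).filter fun v => G.Adj w v)
    (magnetization G (T.erase w) b) b M (fun h v hv => hM h v (Finset.mem_filter.1 hv).1
      (Finset.mem_filter.1 hv).2) h
  have hs : ∀ v ∈ T.erase w, (∑ x ∈ (T.erase w).filter (fun v => G.Adj w v),
      (Pi.single x b : V → ℝ)) v = if G.Adj w v then b else 0 := by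
    intro v hv
    rw [Finset.sum_apply, Finset.sum_pi_single]
    simp [Finset.mem_erase.1 hv]
  refine le_trans (le_of_eq ?_) (key.trans
    (mul_le_mul_of_nonneg_right (Nat.cast_le.2 hn) hM0))
  refine Finset.sum_congr rfl fun u _ => ?_
  congr 2
  · refine magnetization_congr G b (fun v hv => ?_) u
    rw [Pi.add_apply, hs v hv]
  · refine magnetization_congr G b (fun v hv => ?_) u
    rw [Pi.sub_apply, hs v hv]
    split_ifs <;> ring

variable {d : ℕ}

/-- Once its neighbour `w` is removed, `v` plays the part of a tree vertex whose parent is gone: one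
unit of degree is lost. -/
theorem card_adj_erase_le (hG : ∀ v, G.degree v ≤ d + 1) {T : Finset V} {v w : V}
    (hvw : G.Adj w v) :
    ((T.erase w).filter fun u => G.Adj v u).card ≤ d := by
  have h1 : ((T.erase w).filter fun u => G.Adj v u) ⊆ (G.neighborFinset v).erase w := by
    intro u hu
    simp only [Finset.mem_filter, Finset.mem_erase] at hu
    simp [hu.1.1, hu.2]
  have h2 := Finset.card_le_card h1
  rw [Finset.card_erase_of_mem (by simpa using hvw.symm), SimpleGraph.card_neighborFinset_eq_degree]
    at h2
  have := hG v
  omega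

/-- In a graph of maximum degree `d + 1`, the total influence of a shift of the field at a vertex
with at most `d` neighbours is bounded as on the `d`-ary tree. -/
theorem sum_magnetization_sub_le (hG : ∀ v, G.degree v ≤ d + 1) {b t : ℝ} (hb : 0 ≤ b)
    (hbt : Real.tanh b ≤ t)
    (ht : d * t < 1) (T : Finset V) :
    ∀ w ∈ T, (T.filter fun v => G.Adj w v).card ≤ d → ∀ h : V → ℝ,
      ∑ u ∈ T, |magnetization G T b (h + Pi.single w b) u -
        magnetization G T b (h - Pi.single w b) u| ≤ 2 * t / (1 - d * t) := by
  have htanh : 0 ≤ Real.tanh b := by simpa using tanh_strictMono.monotone hb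
  have ht0 : 0 ≤ t := htanh.trans hbt
  have hA : 0 < 1 - d * t := by linarith
  induction T using Finset.strongInduction with
  | H T ih =>
  intro w hw hdeg h
  -- The spin at `w` acts as a field shift at its at most `d` neighbours, and each of them meets the
  -- degree condition of the induction hypothesis in the graph without `w`.
  have hrec := sum_conditional_sub_le G b (2 * t / (1 - d * t)) d (by positivity)
    ((Finset.card_le_card (Finset.filter_subset_filter _ (Finset.erase_subset w T))).trans hdeg)
    (fun h v hv hwv => ih _ (Finset.erase_ssubset hw) v hv (card_adj_erase_le G hG hwv) h) h
  obtain ⟨P, M, hP, hM, key⟩ := exists_conditional G hw b h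
  have up : h + Pi.single w b = Function.update h w (h w + b) := by
    ext v
    rcases eq_or_ne v w with rfl | hv
    · simp
    · simp [hv]
  have down : h - Pi.single w b = Function.update h w (h w - b) := by
    ext v
    rcases eq_or_ne v w with rfl | hv
    · simp
    · simp [hv]
  obtain ⟨z1, m1, k1⟩ := key (h w + b)
  obtain ⟨z2, m2, k2⟩ := key (h w - b)
  rw [← up] at z1 m1 k1
  rw [← down] at z2 m2 k2
  set A := Real.exp (h w) * P with hAdef
  set B := Real.exp (-h w) * M with hBdef
  have hApos : 0 < A := by positivity
  have hBpos : 0 < B := by positivity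
  have a1 : Real.exp (h w + b) * P = A * Real.exp b := by rw [Real.exp_add, hAdef]; ring
  have b1 : Real.exp (-(h w + b)) * M = B * Real.exp (-b) := by
    rw [neg_add, Real.exp_add, hBdef]; ring
  have a2 : Real.exp (h w - b) * P = A * Real.exp (-b) := by
    rw [sub_eq_add_neg, Real.exp_add, hAdef]; ring
  have b2 : Real.exp (-(h w - b)) * M = B * Real.exp b := by
    rw [neg_sub, sub_eq_add_neg, add_comm, Real.exp_add, hBdef]; ring
  rw [a1, b1] at z1 m1
  rw [a2, b2] at z2 m2
  simp only [a1, b1] at k1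
  simp only [a2, b2] at k2
  have hρ := abs_two_state_mean_sub_le hApos hBpos hb
  have hx := Real.exp_pos b
  have hy := Real.exp_pos (-b)
  have hw1 : magnetization G T b (h + Pi.single w b) w - magnetization G T b (h - Pi.single w b) w =
      (A * Real.exp b - B * Real.exp (-b)) / (A * Real.exp b + B * Real.exp (-b)) -
      (A * Real.exp (-b) - B * Real.exp b) / (A * Real.exp (-b) + B * Real.exp b) := by
    rw [magnetization, magnetization, z1, z2, m1, m2, mul_div_mul_left _ _ (by norm_num),
      mul_div_mul_left _ _ (by norm_num)]
  set ρ := (A * Real.exp b - B * Real.exp (-b)) / (A * Real.exp b + B * Real.exp (-b)) -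
      (A * Real.exp (-b) - B * Real.exp b) / (A * Real.exp (-b) + B * Real.exp b) with hρdef
  -- Given the spin at `w`, the field there is irrelevant to the others; the shift only moves mass
  -- `|ρ| / 2` between the two spins.
  have hu1 : ∀ u ∈ T.erase w, |magnetization G T b (h + Pi.single w b) u -
      magnetization G T b (h - Pi.single w b) u| = |ρ| / 2 *
        |magnetization G (T.erase w) b (fun v => h v + if G.Adj w v then b else 0) u -
        magnetization G (T.erase w) b (fun v => h v + if G.Adj w v then -b else 0) u| := by
    intro u hu
    have hne := Finset.ne_of_mem_erase hu
    rw [← abs_two, ← abs_div, ← abs_mul]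
    congr 1
    rw [magnetization, magnetization, z1, z2, (k1 u hne).1, (k2 u hne).1,
      mul_div_mul_left _ _ (by norm_num), mul_div_mul_left _ _ (by norm_num), hρdef]
    field_simp
    ring
  rw [← Finset.add_sum_erase T _ hw, Finset.sum_congr rfl hu1, hw1, ← Finset.mul_sum]
  have hρ2 : |ρ| ≤ 2 * t := hρ.trans (by linarith)
  -- The bound is the fixed point of the recursion: `1 + d * t / (1 - d * t) = 1 / (1 - d * t)`.
  calc |ρ| + |ρ| / 2 * _ ≤ |ρ| + |ρ| / 2 * (d * (2 * t / (1 - d * t))) := by gcongr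
    _ = |ρ| * (1 / (1 - d * t)) := by field_simp; ring
    _ ≤ 2 * t * (1 / (1 - d * t)) := by gcongr
    _ = _ := by ring

/-- The covariances of the spin at `w` with all spins are absolutely summable, uniformly in the
field. -/
theorem sum_abs_covariance_le (hG : ∀ v, G.degree v ≤ d + 1) {b t : ℝ} (hb : 0 ≤ b)
    (hbt : Real.tanh b ≤ t)
    (ht : d * t < 1) (h : V → ℝ) (w : V) :
    ∑ u, |(∑ σ, isingWeight G Finset.univ b h σ * (spin (σ w) * spin (σ u))) *
        (∑ σ, isingWeight G Finset.univ b h σ) -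
      (∑ σ, isingWeight G Finset.univ b h σ * spin (σ w)) *
        (∑ σ, isingWeight G Finset.univ b h σ * spin (σ u))| ≤
      (1 + (d + 1) * t / (1 - d * t)) * (∑ σ, isingWeight G Finset.univ b h σ) ^ 2 := by
  have htanh : 0 ≤ Real.tanh b := by simpa using tanh_strictMono.monotone hb
  have ht0 : 0 ≤ t := htanh.trans hbt
  have hA : 0 < 1 - d * t := by linarith
  have hw := Finset.mem_univ w
  -- The starting vertex is a root with up to `d + 1` neighbours; only its descendants have
  -- branching `d`.
  have hrec := sum_conditional_sub_le G (T := Finset.univ) (w := w) b (2 * t / (1 - d * t)) (d + 1)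
    (by positivity)
    ((Finset.card_le_card (fun v hv => by simpa using (Finset.mem_filter.1 hv).2)).trans
      ((SimpleGraph.card_neighborFinset_eq_degree G w).trans_le (hG w)))
    (fun h v hv hwv => sum_magnetization_sub_le G hG hb hbt ht _ v hv
      (card_adj_erase_le G hG hwv) h) h
  obtain ⟨P, M, hP, hM, key⟩ := exists_conditional G hw b h
  obtain ⟨z, m, k⟩ := key (h w)
  rw [Function.update_eq_self] at z m k
  set A := Real.exp (h w) * P with hAdef
  set B := Real.exp (-h w) * M with hBdef
  have hApos : 0 < A := by positivity
  have hBpos : 0 < B := by positivity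
  set Z := ∑ σ, isingWeight G Finset.univ b h σ with hZ
  have hu1 : ∀ u ∈ Finset.univ.erase w,
      |(∑ σ, isingWeight G Finset.univ b h σ * (spin (σ w) * spin (σ u))) * Z -
      (∑ σ, isingWeight G Finset.univ b h σ * spin (σ w)) *
        (∑ σ, isingWeight G Finset.univ b h σ * spin (σ u))| = A * B / 2 *
        |magnetization G (Finset.univ.erase w) b (fun v => h v + if G.Adj w v then b else 0) u -
        magnetization G (Finset.univ.erase w) b
          (fun v => h v + if G.Adj w v then -b else 0) u| := by
    intro u hu
    have hne := Finset.ne_of_mem_erase hu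
    rw [← abs_of_pos (show 0 < A * B / 2 by positivity), ← abs_mul, z, m, (k u hne).1,
      (k u hne).2]
    congr 1
    ring
  have hself : |(∑ σ, isingWeight G Finset.univ b h σ * (spin (σ w) * spin (σ w))) * Z -
      (∑ σ, isingWeight G Finset.univ b h σ * spin (σ w)) *
        (∑ σ, isingWeight G Finset.univ b h σ * spin (σ w))| = A * B := by
    simp only [spin_mul_self, mul_one]
    rw [← hZ, z, m, ← abs_of_pos (show 0 < A * B by positivity)]
    congr 1
    ring
  rw [← Finset.add_sum_erase _ _ hw, hself, Finset.sum_congr rfl hu1, ← Finset.mul_sum]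
  -- Here `Z = (A + B) / 2`, so this is the arithmetic-geometric mean inequality.
  have hAB : A * B ≤ Z ^ 2 := by rw [z]; nlinarith [sq_nonneg (A - B)]
  have hK : (0 : ℝ) ≤ 1 + (d + 1) * t / (1 - d * t) := by positivity
  push_cast at hrec
  calc A * B + A * B / 2 * _ ≤ A * B + A * B / 2 * ((d + 1) * (2 * t / (1 - d * t))) := by gcongr
    _ = (1 + (d + 1) * t / (1 - d * t)) * (A * B) := by ring
    _ ≤ _ := by gcongr

end Covariance

/-! ### Loss of variance under weak signals -/

theorem abs_prod_one_add_sub_le {ι : Type*} (s : Finset ι) {y : ι → ℝ} {r : ℝ} (hr0 : 0 ≤ r)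
    (hr1 : r ≤ 1) (hy : ∀ i ∈ s, |y i| ≤ r) :
    |∏ i ∈ s, (1 + y i)| ≤ 2 ^ s.card ∧ |∏ i ∈ s, (1 + y i) - 1| ≤ 2 ^ s.card * r ∧
      |∏ i ∈ s, (1 + y i) - 1 - ∑ i ∈ s, y i| ≤ 2 ^ s.card * r ^ 2 := by
  classical
  induction s using Finset.induction_on with
  | empty => simp [hr0]
  | insert a s ha ih =>
    obtain ⟨h1, h2, h3⟩ := ih fun i hi => hy i (Finset.mem_insert_of_mem hi)
    have hya := hy a (Finset.mem_insert_self a s)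
    rw [Finset.prod_insert ha, Finset.sum_insert ha, Finset.card_insert_of_notMem ha, pow_succ]
    set P := ∏ i ∈ s, (1 + y i)
    set S := ∑ i ∈ s, y i
    have hN : (0 : ℝ) ≤ 2 ^ s.card := by positivity
    refine ⟨?_, ?_, ?_⟩
    · have : |1 + y a| ≤ 2 := (abs_add_le _ _).trans (by rw [abs_one]; linarith)
      rw [abs_mul, mul_comm]
      exact mul_le_mul h1 this (abs_nonneg _) hN
    · have e : (1 + y a) * P - 1 = (P - 1) + y a * P := by ring
      rw [e]
      refine (abs_add_le _ _).trans ?_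
      rw [abs_mul]
      have := mul_le_mul hya h1 (abs_nonneg _) hr0
      linarith
    · have e : (1 + y a) * P - 1 - (y a + S) = (P - 1 - S) + y a * (P - 1) := by ring
      rw [e]
      refine (abs_add_le _ _).trans ?_
      rw [abs_mul]
      have := mul_le_mul hya h2 (abs_nonneg _) hr0
      nlinarith

section Channel

variable {Ω E : Type*} [Fintype Ω] [Fintype E] [DecidableEq E]

theorem sum_prod_one_add_spin (x : E → ℝ) :
    ∑ s : E → ℤˣ, ∏ e, (1 + spin (s e) * x e) = 2 ^ Fintype.card E := by
  have := Fintype.prod_sum fun (e : E) (a : ℤˣ) => 1 + spin a * x e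
  rw [← this]
  simp only [sum_units, spin_one, spin_neg_one]
  rw [Finset.prod_congr rfl fun e _ => show (1 + 1 * x e + (1 + -1 * x e)) = (2 : ℝ) by ring]
  simp

/-- Used for two replicas of the configuration that share the signal `s`: the terms linear in a
signal average out. -/
theorem sum_prod_one_add_spin_mul (x y : E → ℝ) :
    ∑ s : E → ℤˣ, (∏ e, (1 + spin (s e) * x e)) * ∏ e, (1 + spin (s e) * y e) =
      2 ^ Fintype.card E * ∏ e, (1 + x e * y e) := by
  have := Fintype.prod_sum fun (e : E) (a : ℤˣ) => (1 + spin a * x e) * (1 + spin a * y e)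
  simp only [← Finset.prod_mul_distrib]
  rw [← this]
  simp only [sum_units, spin_one, spin_neg_one]
  rw [Finset.prod_congr rfl fun e _ =>
    show ((1 + 1 * x e) * (1 + 1 * y e) + (1 + -1 * x e) * (1 + -1 * y e)) =
      2 * (1 + x e * y e) by ring]
  simp [Finset.prod_mul_distrib]

/-- Observing independent weak signals of the functions `x e` decreases the variance of `f`, to
leading order, by its squared covariances with these functions. -/
theorem weightedVariance_mul_le_sum_tilt {w f : Ω → ℝ} (hw : ∀ σ, 0 < w σ)
    (hf : ∑ σ, w σ * f σ = 0) {x : E → Ω → ℝ} {τ κ : ℝ} (hτ0 : 0 ≤ τ) (hx : ∀ e σ, |x e σ| ≤ τ)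
    (hτN : Fintype.card E * τ ≤ 1 / 2) (hτ1 : τ ≤ 1)
    (hκ : ∑ e, (∑ σ, w σ * f σ * x e σ) ^ 2 ≤ κ * ((∑ σ, w σ) * ∑ σ, w σ * f σ ^ 2)) :
    2 ^ Fintype.card E * (1 - 2 * (κ + 2 ^ Fintype.card E * τ ^ 4)) * weightedVariance w f ≤
      ∑ s : E → ℤˣ, weightedVariance (fun σ => w σ * ∏ e, (1 + spin (s e) * x e σ)) f := by
  set N := Fintype.card E with hN
  rcases isEmpty_or_nonempty Ω with hΩ | hΩ
  · simp [weightedVariance]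
  set Z := ∑ σ, w σ with hZdef
  have hZ : 0 < Z := Finset.sum_pos (fun σ _ => hw σ) Finset.univ_nonempty
  set Q := ∑ σ, w σ * f σ ^ 2 with hQdef
  have hV : weightedVariance w f = Q := by simp [weightedVariance, hf, hQdef]
  -- Bernoulli's inequality keeps each tilt above `1 / 2`. Hence each tilted total weight is at
  -- least `Z / 2`, which accounts for the factor `2` before `κ`.
  have hlow : ∀ s : E → ℤˣ, ∀ σ, 1 / 2 ≤ ∏ e, (1 + spin (s e) * x e σ) := by
    intro s σ
    calc (1 : ℝ) / 2 ≤ 1 + N * (-τ) := by linarith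
      _ ≤ (1 + -τ) ^ N := one_add_mul_le_pow (by linarith) N
      _ = ∏ _e : E, (1 + -τ) := by simp [hN]
      _ ≤ _ := by
        refine Finset.prod_le_prod (fun e _ => by linarith) fun e _ => ?_
        have h := abs_le.1 (hx e σ)
        rcases Int.units_eq_one_or (s e) with hs | hs <;> rw [hs] <;> simp <;> linarith
  have hZs : ∀ s : E → ℤˣ, Z / 2 ≤ ∑ σ, w σ * ∏ e, (1 + spin (s e) * x e σ) := by
    intro s
    rw [hZdef, Finset.sum_div]
    exact Finset.sum_le_sum fun σ _ => by
      have := mul_le_mul_of_nonneg_left (hlow s σ) (hw σ).le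
      linarith
  have hfirst : ∑ s : E → ℤˣ, ∑ σ, (w σ * ∏ e, (1 + spin (s e) * x e σ)) * f σ ^ 2 =
      2 ^ N * Q := by
    rw [Finset.sum_comm, hQdef, Finset.mul_sum]
    refine Finset.sum_congr rfl fun σ _ => ?_
    rw [← Finset.sum_mul, ← Finset.mul_sum, sum_prod_one_add_spin]
    ring
  have hexp : ∑ s : E → ℤˣ, (∑ σ, (w σ * ∏ e, (1 + spin (s e) * x e σ)) * f σ) ^ 2 =
      2 ^ N * ∑ σ, ∑ σ', (w σ * f σ) * (w σ' * f σ') * ∏ e, (1 + x e σ * x e σ') := by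
    simp only [pow_two, Finset.sum_mul_sum]
    rw [Finset.sum_comm, Finset.mul_sum]
    refine Finset.sum_congr rfl fun σ _ => ?_
    rw [Finset.sum_comm, Finset.mul_sum]
    refine Finset.sum_congr rfl fun σ' _ => ?_
    have := sum_prod_one_add_spin_mul (fun e => x e σ) (fun e => x e σ')
    rw [mul_left_comm, ← this, Finset.mul_sum]
    exact Finset.sum_congr rfl fun s _ => by ring
  -- Summed over both replicas, the constant term vanishes because `f` is centred, the linear term
  -- gives the squared covariances, and the rest is of order `τ ^ 4`.
  have hrem : ∀ σ σ', (w σ * f σ) * (w σ' * f σ') * ∏ e, (1 + x e σ * x e σ') ≤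
      (w σ * f σ) * (w σ' * f σ') + ∑ e, (w σ * f σ * x e σ) * (w σ' * f σ' * x e σ') +
        2 ^ N * τ ^ 4 * ((w σ * |f σ|) * (w σ' * |f σ'|)) := by
    intro σ σ'
    have h := (abs_prod_one_add_sub_le (Finset.univ : Finset E) (y := fun e => x e σ * x e σ')
      (r := τ ^ 2) (by positivity) (by nlinarith) (fun e _ => by
        rw [abs_mul, pow_two]
        exact mul_le_mul (hx e σ) (hx e σ') (abs_nonneg _) hτ0)).2.2
    rw [Finset.card_univ, ← hN] at h
    have hs : ∑ e, (w σ * f σ * x e σ) * (w σ' * f σ' * x e σ') =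
        (w σ * f σ) * (w σ' * f σ') * ∑ e, x e σ * x e σ' := by
      rw [Finset.mul_sum]
      exact Finset.sum_congr rfl fun e _ => by ring
    have habs : |(w σ * f σ) * (w σ' * f σ')| = (w σ * |f σ|) * (w σ' * |f σ'|) := by
      rw [abs_mul, abs_mul, abs_mul, abs_of_pos (hw σ), abs_of_pos (hw σ')]
    have h1 := mul_le_mul_of_nonneg_left h (abs_nonneg ((w σ * f σ) * (w σ' * f σ')))
    rw [← abs_mul] at h1
    have h2 := (le_abs_self _).trans h1
    rw [habs] at h2
    rw [hs]
    nlinarith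
  have hsq : (∑ σ, w σ * |f σ|) ^ 2 ≤ Z * Q := by
    have := Finset.sum_mul_sq_le_sq_mul_sq Finset.univ (fun σ => √(w σ))
      (fun σ => √(w σ) * |f σ|)
    have e1 : ∀ σ, √(w σ) * (√(w σ) * |f σ|) = w σ * |f σ| := fun σ => by
      rw [← mul_assoc, Real.mul_self_sqrt (hw σ).le]
    have e2 : ∀ σ, √(w σ) ^ 2 = w σ := fun σ => Real.sq_sqrt (hw σ).le
    simpa only [e1, e2, mul_pow, sq_abs] using this
  have hsecond : ∑ σ, ∑ σ', (w σ * f σ) * (w σ' * f σ') * ∏ e, (1 + x e σ * x e σ') ≤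
      (κ + 2 ^ N * τ ^ 4) * (Z * Q) := by
    calc _ ≤ ∑ σ, ∑ σ', ((w σ * f σ) * (w σ' * f σ') +
          ∑ e, (w σ * f σ * x e σ) * (w σ' * f σ' * x e σ') +
          2 ^ N * τ ^ 4 * ((w σ * |f σ|) * (w σ' * |f σ'|))) :=
        Finset.sum_le_sum fun σ _ => Finset.sum_le_sum fun σ' _ => hrem σ σ'
      _ = (∑ σ, w σ * f σ) ^ 2 + ∑ e, (∑ σ, w σ * f σ * x e σ) ^ 2 +
          2 ^ N * τ ^ 4 * (∑ σ, w σ * |f σ|) ^ 2 := by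
        have hsq' : ∀ g : Ω → ℝ, ∑ σ, ∑ σ', g σ * g σ' = (∑ σ, g σ) ^ 2 := fun g => by
          rw [pow_two, Finset.sum_mul_sum]
        have hswap : ∑ σ, ∑ σ', ∑ e, (w σ * f σ * x e σ) * (w σ' * f σ' * x e σ') =
            ∑ e, (∑ σ, w σ * f σ * x e σ) ^ 2 := by
          rw [Finset.sum_congr rfl fun σ _ => Finset.sum_comm, Finset.sum_comm]
          exact Finset.sum_congr rfl fun e _ => hsq' fun σ => w σ * f σ * x e σ
        simp only [Finset.sum_add_distrib, hswap, ← Finset.mul_sum]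
        rw [← hsq' fun σ => w σ * f σ, ← hsq' fun σ => w σ * |f σ|]
        simp only [Finset.mul_sum]
      _ ≤ 0 + κ * (Z * Q) + 2 ^ N * τ ^ 4 * (Z * Q) := by
        rw [hf]
        gcongr
        simp
      _ = _ := by ring
  have hquot : ∑ s : E → ℤˣ, (∑ σ, (w σ * ∏ e, (1 + spin (s e) * x e σ)) * f σ) ^ 2 /
      ∑ σ, w σ * ∏ e, (1 + spin (s e) * x e σ) ≤
      2 ^ N * (2 * (κ + 2 ^ N * τ ^ 4)) * Q := by
    calc _ ≤ ∑ s : E → ℤˣ, (∑ σ, (w σ * ∏ e, (1 + spin (s e) * x e σ)) * f σ) ^ 2 / (Z / 2) :=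
        Finset.sum_le_sum fun s _ => div_le_div_of_nonneg_left (sq_nonneg _) (by positivity) (hZs s)
      _ = 2 ^ N * (∑ σ, ∑ σ', (w σ * f σ) * (w σ' * f σ') * ∏ e, (1 + x e σ * x e σ')) /
          (Z / 2) := by rw [← Finset.sum_div, hexp]
      _ ≤ 2 ^ N * ((κ + 2 ^ N * τ ^ 4) * (Z * Q)) / (Z / 2) := by gcongr
      _ = _ := by field_simp
  rw [hV]
  simp only [weightedVariance]
  rw [Finset.sum_sub_distrib, hfirst]
  linarith

end Channel

/-! ### Bounding the covariance operator and weakening the coupling -/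

section Localization

variable {V : Type*} [Fintype V] [DecidableEq V] (G : SimpleGraph V) [DecidableRel G.Adj]

/-- A duality argument: for `c v` the covariance of `f` with the spin at `v`, the sum of the squares
is the covariance of `f` with `L = ∑ c v * spin v`. Cauchy–Schwarz reduces the claim to the variance
of `L`, which is controlled by the row sums of the covariance matrix. -/
theorem sum_sq_covariance_le {d : ℕ} (hG : ∀ v, G.degree v ≤ d + 1) {b t : ℝ} (hb : 0 ≤ b)
    (hbt : Real.tanh b ≤ t) (ht : d * t < 1) (h : V → ℝ) {f : IsingConfig V → ℝ}
    (hf : ∑ σ, isingWeight G Finset.univ b h σ * f σ = 0) :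
    ∑ v, (∑ σ, isingWeight G Finset.univ b h σ * f σ * spin (σ v)) ^ 2 ≤
      (1 + (d + 1) * t / (1 - d * t)) * ((∑ σ, isingWeight G Finset.univ b h σ) *
        ∑ σ, isingWeight G Finset.univ b h σ * f σ ^ 2) := by
  have hcov := sum_abs_covariance_le G hG hb hbt ht h
  have hZ := partition_pos G Finset.univ b h
  have hwpos := isingWeight_pos G Finset.univ b h
  set w := isingWeight G Finset.univ b h
  set K := 1 + (d + 1) * t / (1 - d * t)
  set Z := ∑ σ, w σ
  set Q := ∑ σ, w σ * f σ ^ 2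
  set c : V → ℝ := fun v => ∑ σ, w σ * f σ * spin (σ v) with hc
  set L : IsingConfig V → ℝ := fun σ => ∑ v, c v * spin (σ v) with hL
  set S := ∑ v, c v ^ 2 with hS
  set m := (∑ σ, w σ * L σ) / Z with hm
  have hcL : S = ∑ σ, w σ * f σ * (L σ - m) := by
    simp only [mul_sub, Finset.sum_sub_distrib, ← Finset.sum_mul, hf, zero_mul, sub_zero, hL,
      Finset.mul_sum]
    rw [Finset.sum_comm, hS]
    refine Finset.sum_congr rfl fun v _ => ?_
    rw [pow_two]
    nth_rewrite 2 [hc]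
    rw [Finset.mul_sum]
    exact Finset.sum_congr rfl fun σ _ => by ring
  have hCS : S ^ 2 ≤ Q * weightedVariance w L := by
    rw [weightedVariance_eq_sum, hcL]
    have := Finset.sum_mul_sq_le_sq_mul_sq Finset.univ (fun σ => √(w σ) * f σ)
      (fun σ => √(w σ) * (L σ - m))
    have e1 : ∀ σ, √(w σ) * f σ * (√(w σ) * (L σ - m)) = w σ * f σ * (L σ - m) := fun σ => by
      have := Real.mul_self_sqrt (hwpos σ).le
      linear_combination f σ * (L σ - m) * this
    have e2 : ∀ σ, √(w σ) ^ 2 = w σ := fun σ => Real.sq_sqrt (hwpos σ).le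
    simpa only [e1, e2, mul_pow] using this
  have hvar : Z * weightedVariance w L ≤ K * Z ^ 2 * S := by
    have e1 : Z * weightedVariance w L = ∑ u, ∑ v, c u * c v *
        ((∑ σ, w σ * (spin (σ u) * spin (σ v))) * Z -
          (∑ σ, w σ * spin (σ u)) * ∑ σ, w σ * spin (σ v)) := by
      have l2 : ∑ σ, w σ * L σ ^ 2 = ∑ u, ∑ v, c u * c v *
          ∑ σ, w σ * (spin (σ u) * spin (σ v)) := by
        simp only [hL, pow_two, Finset.sum_mul_sum]
        simp only [Finset.mul_sum]
        rw [Finset.sum_comm]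
        refine Finset.sum_congr rfl fun u _ => ?_
        rw [Finset.sum_comm]
        exact Finset.sum_congr rfl fun v _ => Finset.sum_congr rfl fun σ _ => by ring
      have l1 : (∑ σ, w σ * L σ) = ∑ u, c u * ∑ σ, w σ * spin (σ u) := by
        simp only [hL, Finset.mul_sum]
        rw [Finset.sum_comm]
        exact Finset.sum_congr rfl fun v _ => Finset.sum_congr rfl fun σ _ => by ring
      have l3 : (∑ σ, w σ * L σ) ^ 2 = ∑ u, ∑ v, (c u * ∑ σ, w σ * spin (σ u)) *
          (c v * ∑ σ, w σ * spin (σ v)) := by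
        rw [l1, pow_two, Finset.sum_mul_sum]
      have : Z * weightedVariance w L = Z * ∑ σ, w σ * L σ ^ 2 - (∑ σ, w σ * L σ) ^ 2 := by
        rw [weightedVariance, mul_sub, mul_div_cancel₀ _ hZ.ne']
      rw [this, l2, l3, Finset.mul_sum, ← Finset.sum_sub_distrib]
      refine Finset.sum_congr rfl fun u _ => ?_
      rw [Finset.mul_sum, ← Finset.sum_sub_distrib]
      exact Finset.sum_congr rfl fun v _ => by ring
    set C : V → V → ℝ := fun u v => (∑ σ, w σ * (spin (σ u) * spin (σ v))) * Z -
          (∑ σ, w σ * spin (σ u)) * ∑ σ, w σ * spin (σ v) with hC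
    have hsymm : ∀ u v, C u v = C v u := fun u v => by
      have : ∀ σ : IsingConfig V, spin (σ u) * spin (σ v) = spin (σ v) * spin (σ u) :=
        fun σ => mul_comm _ _
      simp only [hC, this]
      ring
    -- The Schur test for a symmetric matrix.
    have e2 : ∀ u v, c u * c v * C u v ≤ c u ^ 2 / 2 * |C u v| + c v ^ 2 / 2 * |C v u| := by
      intro u v
      rw [hsymm v u]
      have h1 : c u * c v * C u v ≤ |c u * c v| * |C u v| := by
        rw [← abs_mul]
        exact le_abs_self _
      have h2 : |c u * c v| ≤ c u ^ 2 / 2 + c v ^ 2 / 2 := by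
        rw [abs_le]
        constructor <;> nlinarith [sq_nonneg (c u + c v), sq_nonneg (c u - c v)]
      have := mul_le_mul_of_nonneg_right h2 (abs_nonneg (C u v))
      linarith
    have e3 : ∀ u, c u ^ 2 / 2 * ∑ v, |C u v| ≤ c u ^ 2 / 2 * (K * Z ^ 2) := fun u =>
      mul_le_mul_of_nonneg_left (hcov u) (by positivity)
    rw [e1]
    calc _ ≤ ∑ u, ∑ v, (c u ^ 2 / 2 * |C u v| + c v ^ 2 / 2 * |C v u|) :=
        Finset.sum_le_sum fun u _ => Finset.sum_le_sum fun v _ => e2 u v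
      _ = ∑ u, c u ^ 2 / 2 * ∑ v, |C u v| + ∑ v, c v ^ 2 / 2 * ∑ u, |C v u| := by
        simp only [Finset.sum_add_distrib, Finset.mul_sum]
        congr 1
        exact Finset.sum_comm
      _ ≤ ∑ u, c u ^ 2 / 2 * (K * Z ^ 2) + ∑ u, c u ^ 2 / 2 * (K * Z ^ 2) :=
        add_le_add (Finset.sum_le_sum fun u _ => e3 u) (Finset.sum_le_sum fun u _ => e3 u)
      _ = K * Z ^ 2 * S := by
        rw [← Finset.sum_add_distrib, hS, Finset.mul_sum]
        exact Finset.sum_congr rfl fun u _ => by ring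
  have hQ : 0 ≤ Q := Finset.sum_nonneg fun σ _ => mul_nonneg (hwpos σ).le (sq_nonneg _)
  have hS0 : 0 ≤ S := Finset.sum_nonneg fun v _ => sq_nonneg _
  rcases hS0.eq_or_lt with h0 | h0
  · have hK : 0 ≤ K := by
      have htanh : 0 ≤ Real.tanh b := by simpa using tanh_strictMono.monotone hb
      have ht0 : 0 ≤ t := htanh.trans hbt
      have hA : 0 < 1 - d * t := by linarith
      positivity
    rw [← h0]
    positivity
  · have h1 : Z * S ^ 2 ≤ Q * (K * Z ^ 2 * S) := by
      calc Z * S ^ 2 ≤ Z * (Q * weightedVariance w L) := by gcongr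
        _ = Q * (Z * weightedVariance w L) := by ring
        _ ≤ _ := by gcongr
    have h2 : (Z * S) * S ≤ (Z * S) * (K * (Z * Q)) := by nlinarith
    exact le_of_mul_le_mul_left h2 (by positivity)

/-- The signal of the edge `e` used to weaken the coupling: the rescaled sum of its two spins. -/
noncomputable def edgeSignal (τ : ℝ) (e : V × V) (σ : IsingConfig V) : ℝ :=
  if G.Adj e.1 e.2 then τ * ((spin (σ e.1) + spin (σ e.2)) / 2) else 0

theorem abs_edgeSignal_le {τ : ℝ} (hτ : 0 ≤ τ) (e : V × V) (σ : IsingConfig V) :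
    |edgeSignal G τ e σ| ≤ τ := by
  unfold edgeSignal
  split_ifs
  · rw [abs_mul, abs_of_nonneg hτ]
    refine mul_le_of_le_one_right hτ ?_
    rcases Int.units_eq_one_or (σ e.1) with h1 | h1 <;>
      rcases Int.units_eq_one_or (σ e.2) with h2 | h2 <;> simp [h1, h2]
  · simpa

/-- The discrete Hubbard-Stratonovich transformation: after the signals have been observed, the
model is an Ising model with a weaker coupling in another field. -/
theorem exists_isingWeight_mul_prod_eq {δ τ : ℝ} (hτ0 : 0 ≤ τ) (hτ1 : τ < 1)
    (hτδ : 1 - τ ^ 2 = Real.exp (-2 * δ)) (b : ℝ) (h : V → ℝ) (s : V × V → ℤˣ) :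
    ∃ c : ℝ, 0 < c ∧ ∃ h' : V → ℝ, ∀ σ, isingWeight G Finset.univ b h σ *
      ∏ e, (1 + spin (s e) * edgeSignal G τ e σ) = c * isingWeight G Finset.univ (b - δ) h' σ := by
  -- With this choice `1 ± τ = exp (-δ ± 2 * a)`: an agreeing edge gets factor `1 ± τ`, a
  -- disagreeing one gets `1`. Each edge is observed in both orientations, each costing coupling `δ
  -- / 2`.
  set a := (Real.log (1 + τ) - Real.log (1 - τ)) / 4 with ha
  have hlog : Real.log (1 + τ) + Real.log (1 - τ) = -2 * δ := by
    rw [← Real.log_mul (by linarith) (by linarith), ← Real.log_exp (-2 * δ), ← hτδ]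
    congr 1
    ring
  have hp : 1 + τ = Real.exp (-δ + 2 * a) := by
    rw [← Real.exp_log (show 0 < 1 + τ by linarith)]
    congr 1
    linarith
  have hm : 1 - τ = Real.exp (-δ - 2 * a) := by
    rw [← Real.exp_log (show 0 < 1 - τ by linarith)]
    congr 1
    linarith
  have hfac : ∀ (x y z : ℤˣ), 1 + spin x * (τ * ((spin y + spin z) / 2)) =
      Real.exp (-δ / 2 - δ / 2 * (spin y * spin z) + a * spin x * (spin y + spin z)) := by
    intro x y z
    rcases Int.units_eq_one_or x with rfl | rfl <;>
      rcases Int.units_eq_one_or y with rfl | rfl <;>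
        rcases Int.units_eq_one_or z with rfl | rfl <;> simp only [spin_one, spin_neg_one]
    · convert hp using 1 <;> [skip; congr 1] <;> ring
    · ring_nf; simp
    · ring_nf; simp
    · convert hm using 1 <;> [skip; congr 1] <;> ring
    · convert hm using 1 <;> [skip; congr 1] <;> ring
    · ring_nf; simp
    · ring_nf; simp
    · convert hp using 1 <;> [skip; congr 1] <;> ring
  have hfac' : ∀ e σ, 1 + spin (s e) * edgeSignal G τ e σ = Real.exp (
      (if G.Adj e.1 e.2 then -δ / 2 else 0) -
      δ / 2 * (if G.Adj e.1 e.2 then spin (σ e.1) * spin (σ e.2) else 0) +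
      (if G.Adj e.1 e.2 then a * spin (s e) else 0) * (spin (σ e.1) + spin (σ e.2))) := by
    intro e σ
    unfold edgeSignal
    split_ifs
    · rw [hfac]
    · simp
  refine ⟨Real.exp (∑ e : V × V, if G.Adj e.1 e.2 then -δ / 2 else 0), Real.exp_pos _,
    fun v => h v + ∑ e : V × V, (if G.Adj e.1 e.2 then a * spin (s e) else 0) *
      ((if e.1 = v then 1 else 0) + if e.2 = v then 1 else 0), fun σ => ?_⟩
  rw [Finset.prod_congr rfl fun e _ => hfac' e σ, ← Real.exp_sum]
  unfold isingWeight
  rw [← Real.exp_add, ← Real.exp_add]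
  congr 1
  have e1 : ∑ v, (h v + ∑ e : V × V, (if G.Adj e.1 e.2 then a * spin (s e) else 0) *
      ((if e.1 = v then 1 else 0) + if e.2 = v then 1 else 0)) * spin (σ v) =
      ∑ v, h v * spin (σ v) + ∑ e : V × V, (if G.Adj e.1 e.2 then a * spin (s e) else 0) *
        (spin (σ e.1) + spin (σ e.2)) := by
    simp only [add_mul, Finset.sum_add_distrib, Finset.sum_mul, mul_add, mul_assoc]
    rw [Finset.sum_comm, Finset.sum_comm (f := fun v (e : V × V) =>
      (if G.Adj e.1 e.2 then a * spin (s e) else 0) * ((if e.2 = v then 1 else 0) * spin (σ v)))]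
    simp
  rw [e1]
  simp only [Finset.sum_add_distrib, Finset.sum_sub_distrib, ← Finset.mul_sum]
  rw [Fintype.sum_prod_type (fun e : V × V =>
    if G.Adj e.1 e.2 then spin (σ e.1) * spin (σ e.2) else 0)]
  ring

end Localization

/-! ### Splitting into models of slightly weaker coupling -/

section CouplingDecrease

variable {V : Type*} [Fintype V] [DecidableEq V] (G : SimpleGraph V) [DecidableRel G.Adj]

/-- An edge signal has covariance `τ / 2 * (c u + c v)` with `f`. Convexity of the square splits
this over the ends, and each vertex is charged at most `D` times as first end and `D` times as
second. -/
theorem sum_sq_edgeSignal_le {D : ℕ} (hG : ∀ v, G.degree v ≤ D) (τ : ℝ)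
    (w f : IsingConfig V → ℝ) :
    ∑ e, (∑ σ, w σ * f σ * edgeSignal G τ e σ) ^ 2 ≤
      τ ^ 2 * D * ∑ v, (∑ σ, w σ * f σ * spin (σ v)) ^ 2 := by
  set c : V → ℝ := fun v => ∑ σ, w σ * f σ * spin (σ v) with hc
  have h1 : ∀ e : V × V, (∑ σ, w σ * f σ * edgeSignal G τ e σ) ^ 2 ≤
      if G.Adj e.1 e.2 then τ ^ 2 / 2 * (c e.1 ^ 2 + c e.2 ^ 2) else 0 := by
    intro e
    unfold edgeSignal
    split_ifs
    · have : ∑ σ, w σ * f σ * (τ * ((spin (σ e.1) + spin (σ e.2)) / 2)) =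
          τ / 2 * (c e.1 + c e.2) := by
        simp only [hc]
        rw [← Finset.sum_add_distrib, Finset.mul_sum]
        exact Finset.sum_congr rfl fun σ _ => by ring
      rw [this]
      nlinarith [mul_nonneg (sq_nonneg τ) (sq_nonneg (c e.1 - c e.2))]
    · simp
  have hdeg : ∀ u, ∑ v, (if G.Adj u v then c u ^ 2 else 0) ≤ D * c u ^ 2 := by
    intro u
    rw [← Finset.sum_filter, Finset.sum_const, nsmul_eq_mul, ← SimpleGraph.neighborFinset_eq_filter,
      SimpleGraph.card_neighborFinset_eq_degree]
    exact mul_le_mul_of_nonneg_right (Nat.cast_le.2 (hG u)) (sq_nonneg _)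
  calc _ ≤ ∑ e : V × V, (if G.Adj e.1 e.2 then τ ^ 2 / 2 * (c e.1 ^ 2 + c e.2 ^ 2) else 0) :=
        Finset.sum_le_sum fun e _ => h1 e
    _ = τ ^ 2 / 2 * (∑ u, ∑ v, (if G.Adj u v then c u ^ 2 else 0) +
        ∑ u, ∑ v, (if G.Adj v u then c v ^ 2 else 0)) := by
      rw [Fintype.sum_prod_type, ← Finset.sum_add_distrib, Finset.mul_sum]
      refine Finset.sum_congr rfl fun u _ => ?_
      rw [← Finset.sum_add_distrib, Finset.mul_sum]
      refine Finset.sum_congr rfl fun v _ => ?_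
      simp only [G.adj_comm v u]
      split_ifs <;> ring
    _ ≤ τ ^ 2 / 2 * (∑ u, D * c u ^ 2 + ∑ u, D * c u ^ 2) := by
      rw [Finset.sum_comm (f := fun u v => if G.Adj v u then c v ^ 2 else 0)]
      gcongr <;> exact hdeg _
    _ = τ ^ 2 * D * ∑ v, c v ^ 2 := by
      rw [← Finset.mul_sum]
      ring

/-- An Ising model is a mixture of Ising models with a slightly weaker coupling whose mean variance
is almost that of the given model; the loss per unit of coupling is independent of the graph. -/
theorem exists_mixture_weaker_coupling {d : ℕ} (hG : ∀ v, G.degree v ≤ d + 1) {t : ℝ}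
    (ht0 : 0 ≤ t) (ht : d * t < 1) :
    ∃ δ₀ > 0, ∀ δ, 0 < δ → δ ≤ δ₀ → ∀ b, 0 ≤ b → Real.tanh b ≤ t → ∀ h f,
      ∃ c : (V × V → ℤˣ) → ℝ, (∀ s, 0 < c s) ∧ ∃ k : (V × V → ℤˣ) → V → ℝ,
        (∀ σ, isingWeight G Finset.univ b h σ =
          ∑ s, c s * isingWeight G Finset.univ (b - δ) (k s) σ) ∧
        (1 - 4 * ((d + 1) * (1 + (d + 1) * t / (1 - d * t)) + 1) * δ) *
            weightedVariance (isingWeight G Finset.univ b h) f ≤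
          ∑ s, c s * weightedVariance (isingWeight G Finset.univ (b - δ) (k s)) f := by
  set N := Fintype.card (V × V) with hN
  -- The step size may depend on the graph, as only the rate of loss must not. The term `N ^ 2`
  -- ensures `N * τ ≤ 1 / 2`, and `2 ^ N` lets the fourth-order error be absorbed into `τ ^ 2`.
  refine ⟨1 / (8 * (2 ^ N + N ^ 2)), by positivity, fun δ hδ hδ0 b hb hbt h f => ?_⟩
  set τ := √(1 - Real.exp (-2 * δ)) with hτ
  have hexp1 : Real.exp (-2 * δ) < 1 := by
    rw [← Real.exp_zero]
    exact Real.exp_lt_exp.2 (by linarith)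
  have hτ0 : 0 ≤ τ := Real.sqrt_nonneg _
  have hτsq : τ ^ 2 = 1 - Real.exp (-2 * δ) := Real.sq_sqrt (by linarith)
  have hτ1 : τ < 1 := by
    have := Real.exp_pos (-2 * δ)
    nlinarith
  have hτδ : τ ^ 2 ≤ 2 * δ := by
    have := Real.add_one_le_exp (-2 * δ)
    linarith
  have hsmall : δ * (8 * (2 ^ N + (N : ℝ) ^ 2)) ≤ 1 := by
    rwa [le_div_iff₀ (by positivity)] at hδ0
  have hNτ : N * τ ≤ 1 / 2 := by
    have h1 : (N * τ) ^ 2 ≤ (1 / 2) ^ 2 := by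
      have h2 : (0 : ℝ) ≤ δ * 2 ^ N := by positivity
      have h3 := mul_le_mul_of_nonneg_left hτδ (sq_nonneg (N : ℝ))
      nlinarith
    exact le_of_sq_le_sq h1 (by norm_num)
  have hNτ2 : 2 ^ N * τ ^ 2 ≤ 1 := by
    have h2 : (0 : ℝ) ≤ δ * (N : ℝ) ^ 2 := by positivity
    have h3 := mul_le_mul_of_nonneg_left hτδ (show (0 : ℝ) ≤ 2 ^ N by positivity)
    have h4 : (0 : ℝ) ≤ δ * 2 ^ N := by positivity
    nlinarith
  have hA : 0 < 1 - d * t := by linarith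
  set K := 1 + (d + 1) * t / (1 - d * t) with hK
  have hK0 : 0 ≤ K := by positivity
  choose c hc k hk using exists_isingWeight_mul_prod_eq G hτ0 hτ1
    (show 1 - τ ^ 2 = Real.exp (-2 * δ) by linarith) b h
  set w := isingWeight G Finset.univ b h with hwdef
  have hwpos : ∀ σ, 0 < w σ := isingWeight_pos G Finset.univ b h
  have hZ : 0 < ∑ σ, w σ := partition_pos G Finset.univ b h
  have h2N : (0 : ℝ) < 2 ^ N := by positivity
  refine ⟨fun s => c s / 2 ^ N, fun s => div_pos (hc s) h2N, k, fun σ => ?_, ?_⟩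
  · have : ∀ s, c s / 2 ^ N * isingWeight G Finset.univ (b - δ) (k s) σ =
        w σ / 2 ^ N * ∏ e, (1 + spin (s e) * edgeSignal G τ e σ) := fun s => by
      rw [div_mul_eq_mul_div, ← hk, div_mul_eq_mul_div]
    rw [Finset.sum_congr rfl fun s _ => this s, ← Finset.mul_sum,
      sum_prod_one_add_spin (fun e => edgeSignal G τ e σ), div_mul_cancel₀ _ h2N.ne']
  · set m := (∑ σ, w σ * f σ) / ∑ σ, w σ with hm
    set f₀ : IsingConfig V → ℝ := fun σ => f σ - m with hf₀
    have hf₀mean : ∑ σ, w σ * f₀ σ = 0 := by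
      simp only [hf₀, mul_sub, Finset.sum_sub_distrib, ← Finset.sum_mul]
      rw [hm, mul_div_cancel₀ _ hZ.ne', sub_self]
    have hκ : ∑ e, (∑ σ, w σ * f₀ σ * edgeSignal G τ e σ) ^ 2 ≤
        τ ^ 2 * ((d + 1) * K) * ((∑ σ, w σ) * ∑ σ, w σ * f₀ σ ^ 2) := by
      have h1 := sum_sq_edgeSignal_le G hG τ w f₀
      have h2 := sum_sq_covariance_le G hG hb hbt ht h hf₀mean
      push_cast at h1
      calc _ ≤ _ := h1
        _ ≤ τ ^ 2 * (d + 1) * _ := mul_le_mul_of_nonneg_left h2 (by positivity)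
        _ = _ := by ring
    have key := weightedVariance_mul_le_sum_tilt hwpos hf₀mean hτ0 (abs_edgeSignal_le G hτ0) hNτ
      hτ1.le hκ
    have e1 : ∀ s, weightedVariance (fun σ => w σ * ∏ e, (1 + spin (s e) * edgeSignal G τ e σ)) f₀ =
        c s * weightedVariance (isingWeight G Finset.univ (b - δ) (k s)) f := by
      intro s
      simp only [hk]
      rw [weightedVariance_smul, hf₀, weightedVariance_sub_const (partition_pos G _ _ _).ne']
    rw [Finset.sum_congr rfl fun s _ => e1 s, weightedVariance_sub_const hZ.ne'] at key
    have hV := weightedVariance_nonneg (fun σ => (hwpos σ).le) f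
    have hcoef : 1 - 4 * ((d + 1) * K + 1) * δ ≤
        1 - 2 * (τ ^ 2 * ((d + 1) * K) + 2 ^ N * τ ^ 4) := by
      have h1 : 2 ^ N * τ ^ 4 ≤ τ ^ 2 := by
        have := mul_le_mul_of_nonneg_right hNτ2 (sq_nonneg τ)
        linarith
      have h2 := mul_le_mul_of_nonneg_right hτδ (show 0 ≤ (d + 1) * K + 1 by positivity)
      linarith
    have hfin : 2 ^ N * ((1 - 4 * ((d + 1) * K + 1) * δ) * weightedVariance w f) ≤
        2 ^ N * ∑ s, c s / 2 ^ N *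
          weightedVariance (isingWeight G Finset.univ (b - δ) (k s)) f := by
      calc _ ≤ 2 ^ N * ((1 - 2 * (τ ^ 2 * ((d + 1) * K) + 2 ^ N * τ ^ 4)) *
            weightedVariance w f) := by gcongr
        _ = 2 ^ N * (1 - 2 * (τ ^ 2 * ((d + 1) * K) + 2 ^ N * τ ^ 4)) *
            weightedVariance w f := by ring
        _ ≤ _ := key
        _ = _ := by
          rw [Finset.mul_sum]
          refine Finset.sum_congr rfl fun s _ => ?_
          field_simp
    exact le_of_mul_le_mul_left hfin h2N

end CouplingDecrease

/-! ### Submodularity for commuting projections -/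

section CommutingProjections

variable {V X : Type*} [DecidableEq V] [AddCommGroup X] [Module ℝ X]

/-- The product of the operators `E v` over the entries of `l` that belong to `B`. -/
def partialProd (E : V → Module.End ℝ X) (l : List V) (B : Finset V) : Module.End ℝ X :=
  (l.map fun v => if v ∈ B then E v else 1).prod

variable {E : V → Module.End ℝ X}

theorem partialProd_cons_apply (v : V) (l : List V) (B : Finset V) (f : X) :
    partialProd E (v :: l) B f = (if v ∈ B then E v else 1) (partialProd E l B f) := by
  rw [partialProd, List.map_cons, List.prod_cons]
  rfl

theorem commute_partialProd (hcomm : ∀ u v, Commute (E u) (E v)) (l : List V) (B : Finset V)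
    (v : V) : Commute (E v) (partialProd E l B) := by
  refine Commute.list_prod_right _ _ fun T hT => ?_
  obtain ⟨u, _, rfl⟩ := List.mem_map.1 hT
  split_ifs
  · exact hcomm v u
  · exact Commute.one_right _

variable {N : X → ℝ}

/-- For commuting orthogonal projections, the larger the set of projections, the smaller the
norm. -/
theorem sqnorm_partialProd_le (hcomm : ∀ u v, Commute (E u) (E v)) (hN0 : ∀ f, 0 ≤ N f)
    (hN : ∀ v f, N f = N (E v f) + N (f - E v f)) {A B : Finset V} (hBA : B ⊆ A) (l : List V)
    (f : X) : N (partialProd E l A f) ≤ N (partialProd E l B f) := by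
  induction l generalizing f with
  | nil => simp [partialProd]
  | cons v l ih =>
    have hc : ∀ C : Finset V, E v (partialProd E l C f) = partialProd E l C (E v f) := fun C =>
      LinearMap.congr_fun (commute_partialProd hcomm l C v) f
    have hle : ∀ g, N (E v g) ≤ N g := fun g => by
      have := hN v g
      have := hN0 (g - E v g)
      linarith
    rw [partialProd_cons_apply, partialProd_cons_apply]
    by_cases hA : v ∈ A
    · by_cases hB : v ∈ B
      · simp only [hA, hB, if_true, hc]
        exact ih _
      · simp only [hA, hB, if_true, if_false, Module.End.one_apply]
        exact (hle _).trans (ih _)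
    · have hB : v ∉ B := fun h => hA (hBA h)
      simp only [hA, hB, if_false, Module.End.one_apply]
      exact ih _

/-- The decrease of the norm under commuting orthogonal projections is submodular; in particular
it dominates an additive set function with the same total. -/
theorem exists_additive_minorant [Fintype V] (hcomm : ∀ u v, Commute (E u) (E v))
    (hN0 : ∀ f, 0 ≤ N f) (hN : ∀ v f, N f = N (E v f) + N (f - E v f)) {l : List V}
    (hl : l.Nodup) (f : X) :
    ∃ g : V → ℝ, (∀ v, 0 ≤ g v) ∧
      ∑ v ∈ l.toFinset, g v = N f - N (partialProd E l Finset.univ f) ∧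
      ∀ B : Finset V, ∑ v ∈ l.toFinset with v ∈ B, g v ≤ N f - N (partialProd E l B f) := by
  induction l with
  | nil => exact ⟨fun _ => 0, by simp, by simp [partialProd], by simp [partialProd]⟩
  | cons v l ih =>
    obtain ⟨hv, hl⟩ := List.nodup_cons.1 hl
    obtain ⟨g, hg0, hsum, hB⟩ := ih hl
    have hv' : v ∉ l.toFinset := by simpa using hv
    have hdrop : ∀ C : Finset V, N (partialProd E l C f) - N (E v (partialProd E l C f)) =
        N (partialProd E l C (f - E v f)) := fun C => by
      rw [map_sub, ← show E v (partialProd E l C f) = partialProd E l C (E v f) from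
        LinearMap.congr_fun (commute_partialProd hcomm l C v) f]
      have := hN v (partialProd E l C f)
      linarith
    have hcongr : ∀ u ∈ l.toFinset, Function.update g v
        (N (partialProd E l Finset.univ (f - E v f))) u = g u := fun u hu =>
      Function.update_of_ne (ne_of_mem_of_not_mem hu hv') _ _
    -- The new vertex is assigned the drop caused by `E v` after all the other projections of the
    -- list.
    refine ⟨Function.update g v (N (partialProd E l Finset.univ (f - E v f))), fun u => ?_, ?_,
      fun B => ?_⟩
    · rcases eq_or_ne u v with rfl | hu
      · simp [hN0]
      · simp [hu, hg0]
    · rw [List.toFinset_cons, Finset.sum_insert hv', Finset.sum_congr rfl hcongr, hsum,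
        partialProd_cons_apply, Function.update_self, ← hdrop]
      simp
    · rw [List.toFinset_cons, Finset.filter_insert, partialProd_cons_apply]
      have hcongr' : ∑ u ∈ l.toFinset with u ∈ B, Function.update g v
          (N (partialProd E l Finset.univ (f - E v f))) u = ∑ u ∈ l.toFinset with u ∈ B, g u :=
        Finset.sum_congr rfl fun u hu => hcongr u (Finset.mem_filter.1 hu).1
      split_ifs with hvB
      · rw [Finset.sum_insert (by simp [hv]), hcongr', Function.update_self]
        -- Diminishing returns: after only the projections in `B`, applying `E v` removes at least
        -- as much.
        have h1 := sqnorm_partialProd_le hcomm hN0 hN (Finset.subset_univ B) l (f - E v f)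
        have h2 := hdrop B
        have h3 := hB B
        linarith
      · rw [hcongr']
        exact hB B

end CommutingProjections

/-! ### Product measures and averaging over spins -/

section SpinAveraging

variable {V : Type*} [DecidableEq V]

/-- The operator averaging over the spin at `v`, which is `1` with probability `p v`. -/
def spinAverage (p : V → ℝ) (v : V) : Module.End ℝ (IsingConfig V → ℝ) where
  toFun f σ := p v * f (Function.update σ v 1) + (1 - p v) * f (Function.update σ v (-1))
  map_add' f g := by
    ext σ
    simp only [Pi.add_apply]
    ring
  map_smul' c f := by
    ext σ
    simp only [Pi.smul_apply, smul_eq_mul, RingHom.id_apply]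
    ring

theorem spinAverage_apply (p : V → ℝ) (v : V) (f : IsingConfig V → ℝ) (σ : IsingConfig V) :
    spinAverage p v f σ =
      p v * f (Function.update σ v 1) + (1 - p v) * f (Function.update σ v (-1)) := rfl

theorem spinAverage_update (p : V → ℝ) (v : V) (f : IsingConfig V → ℝ) (σ : IsingConfig V)
    (x : ℤˣ) : spinAverage p v f (Function.update σ v x) = spinAverage p v f σ := by
  simp [spinAverage_apply]

theorem spinAverage_eq_self (p : V → ℝ) (v : V) {f : IsingConfig V → ℝ}
    (hf : ∀ σ x, f (Function.update σ v x) = f σ) : spinAverage p v f = f := by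
  ext σ
  rw [spinAverage_apply, hf, hf]
  ring

theorem spinAverage_idem (p : V → ℝ) (v : V) (f : IsingConfig V → ℝ) :
    spinAverage p v (spinAverage p v f) = spinAverage p v f :=
  spinAverage_eq_self p v (spinAverage_update p v f)

theorem commute_spinAverage (p : V → ℝ) (u v : V) :
    Commute (spinAverage p u) (spinAverage p v) := by
  rcases eq_or_ne u v with rfl | h
  · exact Commute.refl _
  · refine LinearMap.ext fun f => funext fun σ => ?_
    simp only [Module.End.mul_apply, spinAverage_apply, Function.update_comm h]
    ring

variable [Fintype V] {p : V → ℝ} {ν : IsingConfig V → ℝ}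

/-- The hypotheses say that under `ν` the spin at `v` is independent of the rest, with `p v` the
probability of `1`. Averaging it out is then a conditional expectation, hence self-adjoint. -/
theorem sum_mul_spinAverage_comm {v : V} {ρ : IsingConfig V → ℝ}
    (h1 : ∀ σ, ν (Function.update σ v 1) = p v * ρ σ)
    (h2 : ∀ σ, ν (Function.update σ v (-1)) = (1 - p v) * ρ σ) (f g : IsingConfig V → ℝ) :
    ∑ σ, ν σ * (spinAverage p v f σ * g σ) = ∑ σ, ν σ * (f σ * spinAverage p v g σ) := by
  rw [sum_config_update v, sum_config_update v (fun σ => ν σ * (f σ * spinAverage p v g σ))]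
  congr 1
  refine Finset.sum_congr rfl fun σ _ => ?_
  rw [spinAverage_update, spinAverage_update, spinAverage_update, spinAverage_update, h1, h2,
    spinAverage_apply, spinAverage_apply]
  ring

/-- Pythagoras for a self-adjoint idempotent. -/
theorem sum_mul_sq_spinAverage {v : V} {ρ : IsingConfig V → ℝ}
    (h1 : ∀ σ, ν (Function.update σ v 1) = p v * ρ σ)
    (h2 : ∀ σ, ν (Function.update σ v (-1)) = (1 - p v) * ρ σ) (f : IsingConfig V → ℝ) :
    ∑ σ, ν σ * f σ ^ 2 = ∑ σ, ν σ * spinAverage p v f σ ^ 2 +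
      ∑ σ, ν σ * (f - spinAverage p v f) σ ^ 2 := by
  have h := sum_mul_spinAverage_comm h1 h2 f (spinAverage p v f)
  rw [spinAverage_idem] at h
  rw [← Finset.sum_add_distrib]
  have e : ∑ σ, (ν σ * spinAverage p v f σ ^ 2 + ν σ * (f - spinAverage p v f) σ ^ 2) =
      ∑ σ, ν σ * f σ ^ 2 + 2 * (∑ σ, ν σ * (spinAverage p v f σ * spinAverage p v f σ) -
        ∑ σ, ν σ * (f σ * spinAverage p v f σ)) := by
    rw [← Finset.sum_sub_distrib, Finset.mul_sum, ← Finset.sum_add_distrib]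
    exact Finset.sum_congr rfl fun σ _ => by simp only [Pi.sub_apply]; ring
  rw [e, h]
  ring

theorem eq_of_update_invariant {φ : IsingConfig V → ℝ}
    (hφ : ∀ v σ x, φ (Function.update σ v x) = φ σ) (σ τ : IsingConfig V) : φ τ = φ σ := by
  have : ∀ S : Finset V, φ (S.piecewise τ σ) = φ σ := by
    intro S
    induction S using Finset.induction_on with
    | empty => simp
    | insert a S _ ih => rw [Finset.piecewise_insert, hφ, ih]
  simpa using this Finset.univ

theorem sum_mul_partialProd {ρ : V → IsingConfig V → ℝ}
    (h1 : ∀ v σ, ν (Function.update σ v 1) = p v * ρ v σ)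
    (h2 : ∀ v σ, ν (Function.update σ v (-1)) = (1 - p v) * ρ v σ) (l : List V) (B : Finset V)
    {g : IsingConfig V → ℝ} (hg : ∀ v ∈ B, ∀ σ x, g (Function.update σ v x) = g σ)
    (f : IsingConfig V → ℝ) :
    ∑ σ, ν σ * (partialProd (spinAverage p) l B f σ * g σ) = ∑ σ, ν σ * (f σ * g σ) := by
  induction l with
  | nil => simp [partialProd]
  | cons v l ih =>
    rw [← ih]
    rw [partialProd_cons_apply]
    split_ifs with hv
    · rw [sum_mul_spinAverage_comm (h1 v) (h2 v), spinAverage_eq_self p v (hg v hv)]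
    · rfl

/-- For a product measure, the mean conditional variances given observations of the spins outside
a set dominate, as functions of the set, an additive set function whose total is the variance. -/
theorem exists_conditional_variance_minorant (hν : ∀ σ, 0 < ν σ) {ρ : V → IsingConfig V → ℝ}
    (h1 : ∀ v σ, ν (Function.update σ v 1) = p v * ρ v σ)
    (h2 : ∀ v σ, ν (Function.update σ v (-1)) = (1 - p v) * ρ v σ) (f : IsingConfig V → ℝ) :
    ∃ g : V → ℝ, (∀ v, 0 ≤ g v) ∧ ∑ v, g v = weightedVariance ν f ∧
      ∀ (B : Finset V) {Y : Type _} [DecidableEq Y] (s : Finset Y) (φ : IsingConfig V → Y),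
        (∀ σ, φ σ ∈ s) → (∀ v ∈ B, ∀ σ x, φ (Function.update σ v x) = φ σ) →
        ∑ v ∈ B, g v ≤
          ∑ y ∈ s, weightedVariance (fun σ => ν σ * if φ σ = y then 1 else 0) f := by
  obtain ⟨g, hg0, hsum, hB⟩ := exists_additive_minorant (E := spinAverage p)
    (N := fun f => ∑ σ, ν σ * f σ ^ 2) (commute_spinAverage p)
    (fun f => Finset.sum_nonneg fun σ _ => mul_nonneg (hν σ).le (sq_nonneg _))
    (fun v f => sum_mul_sq_spinAverage (h1 v) (h2 v) f) (Finset.nodup_toList Finset.univ) f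
  simp only [Finset.toList_toFinset, Finset.filter_univ_mem] at hsum hB
  refine ⟨g, hg0, ?_, fun B Y _ s φ hs hφ => (hB B).trans ?_⟩
  · rw [hsum]
    -- Averaging over every spin leaves a constant, which must be the mean; so the total drop in
    -- norm is the variance.
    set T := partialProd (spinAverage p) Finset.univ.toList Finset.univ f with hT
    have hinv : ∀ v σ x, T (Function.update σ v x) = T σ := by
      intro v
      have hfix : spinAverage p v T = T := by
        have hmem : v ∈ (Finset.univ : Finset V).toList := by simp
        have : ∀ l : List V, v ∈ l → spinAverage p v (partialProd (spinAverage p) l Finset.univ f) =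
            partialProd (spinAverage p) l Finset.univ f := by
          intro l
          induction l with
          | nil => simp
          | cons u l ih =>
            intro hv
            rw [partialProd_cons_apply, if_pos (Finset.mem_univ u)]
            rcases List.mem_cons.1 hv with rfl | hv
            · rw [spinAverage_idem]
            · rw [← Module.End.mul_apply, (commute_spinAverage p v u).eq, Module.End.mul_apply,
                ih hv]
        exact this _ hmem
      intro σ x
      rw [← hfix, spinAverage_update]
    set c := T 1 with hc
    have hTc : ∀ σ, T σ = c := fun σ => eq_of_update_invariant hinv 1 σ
    have hmean := sum_mul_partialProd h1 h2 Finset.univ.toList Finset.univ (g := fun _ => 1)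
      (fun _ _ _ _ => rfl) f
    rw [← hT] at hmean
    simp only [hTc, mul_one, ← Finset.sum_mul] at hmean ⊢
    have hZ : 0 < ∑ σ, ν σ := Finset.sum_pos (fun σ _ => hν σ) Finset.univ_nonempty
    rw [weightedVariance, ← hmean]
    field_simp
  · set T := partialProd (spinAverage p) Finset.univ.toList B f with hT
    have htot : ∀ F : IsingConfig V → ℝ,
        ∑ y ∈ s, ∑ σ, (ν σ * if φ σ = y then 1 else 0) * F σ = ∑ σ, ν σ * F σ := by
      intro F
      rw [Finset.sum_comm]
      refine Finset.sum_congr rfl fun σ _ => ?_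
      rw [← Finset.sum_mul, ← Finset.mul_sum, Finset.sum_ite_eq, if_pos (hs σ), mul_one]
    have hle : ∀ y ∈ s, ∑ σ, (ν σ * if φ σ = y then 1 else 0) * f σ ^ 2 -
        ∑ σ, (ν σ * if φ σ = y then 1 else 0) * T σ ^ 2 ≤
        weightedVariance (fun σ => ν σ * if φ σ = y then 1 else 0) f := by
      intro y _
      have hnn := weightedVariance_nonneg (w := fun σ => ν σ * if φ σ = y then 1 else 0)
        (fun σ => mul_nonneg (hν σ).le (by split_ifs <;> norm_num)) T
      have hm : ∑ σ, (ν σ * if φ σ = y then 1 else 0) * T σ =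
          ∑ σ, (ν σ * if φ σ = y then 1 else 0) * f σ := by
        have := sum_mul_partialProd h1 h2 Finset.univ.toList B
          (g := fun σ => if φ σ = y then 1 else 0) (fun v hv σ x => by rw [hφ v hv]) f
        rw [← hT] at this
        simpa only [mul_assoc, mul_comm, mul_left_comm] using this
      rw [weightedVariance, hm] at hnn
      rw [weightedVariance]
      linarith
    calc _ = _ := by rw [← htot, ← htot]
      _ = ∑ y ∈ s, (∑ σ, (ν σ * if φ σ = y then 1 else 0) * f σ ^ 2 -
          ∑ σ, (ν σ * if φ σ = y then 1 else 0) * T σ ^ 2) := (Finset.sum_sub_distrib _ _).symm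
      _ ≤ _ := Finset.sum_le_sum hle

end SpinAveraging

/-! ### How much variance survives the percolation step -/

section Percolation

variable {V : Type*} [Fintype V] [DecidableEq V] (G : SimpleGraph V) [DecidableRel G.Adj]

theorem mem_agreeingEdges {σ : IsingConfig V} {e : Sym2 V} :
    e ∈ agreeingEdges G σ ↔ e ∈ G.edgeSet ∧ ∀ v ∈ e, ∀ w ∈ e, σ v = σ w := by
  simp [agreeingEdges]

theorem agreeingEdges_subset (σ : IsingConfig V) : agreeingEdges G σ ⊆ G.edgeFinset := fun _ he =>
  SimpleGraph.mem_edgeFinset.2 ((mem_agreeingEdges G).1 he).1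

/-- The probability that the percolation step from `σ` produces `F`. -/
noncomputable def percolationKernel (β : ℝ) (F : Finset (Sym2 V)) (σ : IsingConfig V) : ℝ :=
  if F ⊆ agreeingEdges G σ then percolationProb G β σ F else 0

variable {β : ℝ}

theorem percolationKernel_nonneg (hβ : 0 ≤ β) (F : Finset (Sym2 V)) (σ : IsingConfig V) :
    0 ≤ percolationKernel G β F σ := by
  have : Real.exp (-2 * β) ≤ 1 := by
    rw [← Real.exp_zero]
    exact Real.exp_le_exp.2 (by linarith)
  have h1 : 0 ≤ 1 - Real.exp (-2 * β) := by linarith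
  unfold percolationKernel percolationProb
  split_ifs <;> positivity

/-- The percolation step may be performed by percolation on all edges, followed by the removal of
the edges that do not agree. -/
theorem percolationKernel_eq_sum (β : ℝ) (F : Finset (Sym2 V)) (σ : IsingConfig V) :
    percolationKernel G β F σ = ∑ η ∈ G.edgeFinset.powerset,
      (1 - Real.exp (-2 * β)) ^ η.card * Real.exp (-2 * β) ^ (G.edgeFinset.card - η.card) *
        if η ∩ agreeingEdges G σ = F then 1 else 0 := by
  unfold percolationKernel percolationProb
  set q := Real.exp (-2 * β)
  have hsub := agreeingEdges_subset G σ
  simp only [mul_ite, mul_one, mul_zero]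
  rw [← Finset.sum_filter]
  split_ifs with hF
  · have hsum : ∑ ζ ∈ (G.edgeFinset \ agreeingEdges G σ).powerset, (1 - q) ^ ζ.card *
        q ^ ((G.edgeFinset \ agreeingEdges G σ).card - ζ.card) = 1 := by
      rw [Finset.sum_pow_mul_eq_add_pow]
      simp
    refine (mul_one _).symm.trans ((congrArg _ hsum.symm).trans ?_)
    rw [Finset.mul_sum]
    -- An `η` that leaves `F` is `F` together with arbitrary non-agreeing edges `ζ`, whose total
    -- probability is `1`.
    refine Finset.sum_bij' (fun ζ _ => F ∪ ζ) (fun η _ => η \ agreeingEdges G σ) ?_ ?_ ?_ ?_ ?_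
    · intro ζ hζ
      rw [Finset.mem_powerset] at hζ
      rw [Finset.mem_filter, Finset.mem_powerset]
      refine ⟨Finset.union_subset (hF.trans hsub) (hζ.trans Finset.sdiff_subset), ?_⟩
      ext e
      have h1 := @hζ e
      have h2 := @hF e
      simp only [Finset.mem_sdiff] at h1
      simp only [Finset.mem_inter, Finset.mem_union]
      tauto
    · intro η hη
      rw [Finset.mem_filter, Finset.mem_powerset] at hη
      exact Finset.mem_powerset.2 (Finset.sdiff_subset_sdiff hη.1 subset_rfl)
    · intro ζ hζ
      rw [Finset.mem_powerset] at hζ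
      ext e
      have h1 := @hζ e
      have h2 := @hF e
      simp only [Finset.mem_sdiff] at h1
      simp only [Finset.mem_sdiff, Finset.mem_union]
      tauto
    · intro η hη
      rw [Finset.mem_filter] at hη
      rw [← hη.2]
      ext e
      simp only [Finset.mem_sdiff, Finset.mem_union, Finset.mem_inter]
      tauto
    · intro ζ hζ
      rw [Finset.mem_powerset] at hζ
      have hdisj : Disjoint F ζ := Finset.disjoint_of_subset_left hF
        (Finset.disjoint_of_subset_right hζ Finset.disjoint_sdiff)
      have c1 := Finset.card_le_card hF
      have c2 := Finset.card_le_card hζ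
      have c3 := Finset.card_sdiff_add_card_eq_card hsub
      have c4 : G.edgeFinset.card - (F.card + ζ.card) = ((agreeingEdges G σ).card - F.card) +
          ((G.edgeFinset \ agreeingEdges G σ).card - ζ.card) := by omega
      rw [Finset.card_union_of_disjoint hdisj, c4, pow_add, pow_add]
      ring
  · symm
    refine Finset.sum_eq_zero fun η hη => absurd ?_ hF
    rw [← (Finset.mem_filter.1 hη).2]
    exact Finset.inter_subset_right

/-- The mean conditional variance of `f` given the result of the percolation step, for the weight
`w` on configurations. -/
noncomputable def percolationVariance (β : ℝ) (w f : IsingConfig V → ℝ) : ℝ :=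
  ∑ F ∈ G.edgeFinset.powerset, weightedVariance (fun σ => w σ * percolationKernel G β F σ) f

/-- Revealing the mixture component besides `F` conditions on more. The kernel must be the same for
all components, which is why `β` is decoupled from the coupling of the weights. -/
theorem sum_percolationVariance_le (hβ : 0 ≤ β) {ι : Type*} (s : Finset ι) {c : ι → ℝ}
    (hc : ∀ i, 0 < c i) {w : ι → IsingConfig V → ℝ} (hw : ∀ i σ, 0 < w i σ)
    (f : IsingConfig V → ℝ) :
    ∑ i ∈ s, c i * percolationVariance G β (w i) f ≤
      percolationVariance G β (fun σ => ∑ i ∈ s, c i * w i σ) f := by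
  unfold percolationVariance
  simp only [Finset.mul_sum]
  rw [Finset.sum_comm]
  refine Finset.sum_le_sum fun F _ => ?_
  simp only [← weightedVariance_smul, Finset.sum_mul, ← mul_assoc]
  exact sum_weightedVariance_le s (fun i _ σ => mul_nonneg (mul_pos (hc i) (hw i σ)).le
    (percolationKernel_nonneg G hβ F σ)) f

/-- A vertex of degree at most `D` is isolated with probability at least `exp (-2β) ^ D`. -/
theorem pow_le_sum_isolated {D : ℕ} (hβ : 0 ≤ β) {v : V} (hv : G.degree v ≤ D) :
    Real.exp (-2 * β) ^ D ≤ ∑ η ∈ G.edgeFinset.powerset,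
      (1 - Real.exp (-2 * β)) ^ η.card * Real.exp (-2 * β) ^ (G.edgeFinset.card - η.card) *
        if ∀ e ∈ η, v ∉ e then 1 else 0 := by
  have hq1 : Real.exp (-2 * β) ≤ 1 := by
    rw [← Real.exp_zero]
    exact Real.exp_le_exp.2 (by linarith)
  have hq0 := Real.exp_pos (-2 * β)
  set q := Real.exp (-2 * β)
  set E' := G.edgeFinset.filter fun e => v ∉ e with hE'
  simp only [mul_ite, mul_one, mul_zero]
  rw [← Finset.sum_filter]
  have hset : (G.edgeFinset.powerset.filter fun η => ∀ e ∈ η, v ∉ e) = E'.powerset := by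
    ext η
    simp only [Finset.mem_filter, Finset.mem_powerset, hE', Finset.subset_iff]
    exact ⟨fun h e he => ⟨h.1 he, h.2 e he⟩, fun h => ⟨fun e he => (h he).1, fun e he => (h he).2⟩⟩
  have hcard : G.edgeFinset.card = E'.card + G.degree v := by
    rw [← SimpleGraph.card_incidenceFinset_eq_degree,
      SimpleGraph.incidenceFinset_eq_filter, add_comm]
    exact (Finset.card_filter_add_card_filter_not _).symm
  rw [hset]
  calc q ^ D ≤ q ^ G.degree v := pow_le_pow_of_le_one hq0.le hq1 hv
    _ = q ^ G.degree v * ∑ η ∈ E'.powerset, (1 - q) ^ η.card * q ^ (E'.card - η.card) := by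
      rw [Finset.sum_pow_mul_eq_add_pow]
      simp
    _ = _ := by
      rw [Finset.mul_sum]
      refine Finset.sum_congr rfl fun η hη => ?_
      have := Finset.card_le_card (Finset.mem_powerset.1 hη)
      have e : G.edgeFinset.card - η.card = G.degree v + (E'.card - η.card) := by omega
      rw [e, pow_add]
      ring

/-- For a product measure, the percolation step preserves a fixed fraction of the variance. -/
theorem pow_mul_weightedVariance_le_of_product {D : ℕ} (hG : ∀ v, G.degree v ≤ D) (hβ : 0 ≤ β)
    (h : V → ℝ) (f : IsingConfig V → ℝ) :
    Real.exp (-2 * β) ^ D * weightedVariance (isingWeight G Finset.univ 0 h) f ≤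
      percolationVariance G β (isingWeight G Finset.univ 0 h) f := by
  have hνpos := isingWeight_pos G Finset.univ 0 h
  have hup := fun v σ => isingWeight_update G (Finset.mem_univ v) 0 h σ 1
  have hdown := fun v σ => isingWeight_update G (Finset.mem_univ v) 0 h σ (-1)
  simp only [ite_self, add_zero, spin_one, spin_neg_one, mul_one, mul_neg, neg_zero] at hup hdown
  set ν := isingWeight G Finset.univ 0 h
  set p : V → ℝ := fun v => Real.exp (h v) / (Real.exp (h v) + Real.exp (-h v)) with hp
  obtain ⟨g, hg0, hgsum, hg⟩ := exists_conditional_variance_minorant (p := p) hνpos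
    (ρ := fun v σ => (Real.exp (h v) + Real.exp (-h v)) *
      isingWeight G (Finset.univ.erase v) 0 h σ)
    (fun v σ => by
      rw [hup, hp]
      have := Real.exp_pos (h v)
      have := Real.exp_pos (-h v)
      field_simp)
    (fun v σ => by
      rw [hdown, hp]
      have := Real.exp_pos (h v)
      have := Real.exp_pos (-h v)
      field_simp
      ring) f
  have hq1 : Real.exp (-2 * β) ≤ 1 := by
    rw [← Real.exp_zero]
    exact Real.exp_le_exp.2 (by linarith)
  set π : Finset (Sym2 V) → ℝ := fun η =>
    (1 - Real.exp (-2 * β)) ^ η.card * Real.exp (-2 * β) ^ (G.edgeFinset.card - η.card) with hπ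
  have hπ0 : ∀ η, 0 ≤ π η := fun η => by
    have : 0 ≤ 1 - Real.exp (-2 * β) := by linarith
    have := Real.exp_pos (-2 * β)
    simp only [hπ]
    positivity
  -- For fixed `η`, the edges of `η` that agree do not involve the spins at vertices isolated in
  -- `η`.
  have hobs : ∀ η ∈ G.edgeFinset.powerset, ∑ v with ∀ e ∈ η, v ∉ e, g v ≤
      ∑ F ∈ G.edgeFinset.powerset,
        weightedVariance (fun σ => ν σ * if η ∩ agreeingEdges G σ = F then 1 else 0) f := by
    intro η hη
    refine hg _ _ (fun σ => η ∩ agreeingEdges G σ) (fun σ => ?_) fun v hv σ x => ?_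
    · exact Finset.mem_powerset.2 (Finset.inter_subset_left.trans (Finset.mem_powerset.1 hη))
    · ext e
      simp only [Finset.mem_inter, mem_agreeingEdges]
      refine and_congr_right fun he => and_congr_right fun _ => ?_
      have hve : v ∉ e := (Finset.mem_filter.1 hv).2 e he
      refine forall₂_congr fun a ha => forall₂_congr fun b hb => ?_
      rw [Function.update_of_ne (ne_of_mem_of_not_mem ha hve),
        Function.update_of_ne (ne_of_mem_of_not_mem hb hve)]
  calc Real.exp (-2 * β) ^ D * weightedVariance ν f
      = ∑ v, g v * Real.exp (-2 * β) ^ D := by rw [← hgsum, mul_comm, Finset.sum_mul]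
    _ ≤ ∑ v, g v * ∑ η ∈ G.edgeFinset.powerset, π η * if ∀ e ∈ η, v ∉ e then 1 else 0 :=
      Finset.sum_le_sum fun v _ =>
        mul_le_mul_of_nonneg_left (pow_le_sum_isolated G hβ (hG v)) (hg0 v)
    _ = ∑ η ∈ G.edgeFinset.powerset, π η * ∑ v with ∀ e ∈ η, v ∉ e, g v := by
      simp only [Finset.mul_sum]
      rw [Finset.sum_comm]
      refine Finset.sum_congr rfl fun η _ => ?_
      rw [Finset.sum_filter]
      refine Finset.sum_congr rfl fun v _ => ?_
      split_ifs <;> ring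
    _ ≤ ∑ η ∈ G.edgeFinset.powerset, π η * ∑ F ∈ G.edgeFinset.powerset,
        weightedVariance (fun σ => ν σ * if η ∩ agreeingEdges G σ = F then 1 else 0) f :=
      Finset.sum_le_sum fun η hη => mul_le_mul_of_nonneg_left (hobs η hη) (hπ0 η)
    _ = ∑ F ∈ G.edgeFinset.powerset, ∑ η ∈ G.edgeFinset.powerset, weightedVariance
        (fun σ => π η * (ν σ * if η ∩ agreeingEdges G σ = F then 1 else 0)) f := by
      simp only [weightedVariance_smul, Finset.mul_sum]
      exact Finset.sum_comm
    -- Only `F` is observed in the end; forgetting `η` can only raise the conditional variance.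
    _ ≤ _ := by
      refine Finset.sum_le_sum fun F _ => ?_
      refine (sum_weightedVariance_le _ (fun η _ σ => ?_) f).trans (le_of_eq ?_)
      · refine mul_nonneg (hπ0 η) (mul_nonneg (hνpos σ).le ?_)
        split_ifs <;> norm_num
      · congr 1
        ext σ
        rw [percolationKernel_eq_sum, Finset.mul_sum]
        exact Finset.sum_congr rfl fun η _ => mul_left_comm _ _ _

/-- In the tree uniqueness region, the percolation step preserves a fraction of the variance that
does not depend on the graph or on the field. -/
theorem exp_mul_weightedVariance_le_percolationVariance {d : ℕ} (hG : ∀ v, G.degree v ≤ d + 1)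
    (hβ : 0 < β) (ht : d * Real.tanh β < 1) (h : V → ℝ) (f : IsingConfig V → ℝ) :
    Real.exp (-8 * ((d + 1) * (1 + (d + 1) * Real.tanh β / (1 - d * Real.tanh β)) + 1) * β) *
        Real.exp (-2 * β) ^ (d + 1) * weightedVariance (isingWeight G Finset.univ β h) f ≤
      percolationVariance G β (isingWeight G Finset.univ β h) f := by
  have ht0 : 0 ≤ Real.tanh β := by simpa using tanh_strictMono.monotone hβ.le
  obtain ⟨δ₀, hδ₀, hstep⟩ := exists_mixture_weaker_coupling G hG ht0 ht
  have hA : 0 < 1 - d * Real.tanh β := by linarith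
  set L := 4 * ((d + 1) * (1 + (d + 1) * Real.tanh β / (1 - d * Real.tanh β)) + 1) with hL
  have hLpos : 0 < L := by positivity
  -- The number of steps depends on the graph, but disappears from the total loss since `m * δ = β`.
  -- The second bound gives `L * δ ≤ 1 / 2`, needed for `exp (-2 * x) ≤ 1 - x`.
  obtain ⟨m, hm⟩ := exists_nat_gt (max (β / δ₀) (2 * L * β))
  have hm1 : β / δ₀ < m := (le_max_left _ _).trans_lt hm
  have hm2 : 2 * L * β < m := (le_max_right _ _).trans_lt hm
  have hm0 : (0 : ℝ) < m := lt_trans (by positivity) hm1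
  set δ := β / m with hδ
  have hδpos : 0 < δ := div_pos hβ hm0
  have hδle : δ ≤ δ₀ := by
    rw [hδ, div_le_iff₀ hm0]
    rw [div_lt_iff₀ hδ₀] at hm1
    linarith
  have hLδ : L * δ ≤ 1 / 2 := by
    rw [hδ, ← mul_div_assoc, div_le_iff₀ hm0]
    linarith
  have hexp : Real.exp (-2 * (L * δ)) ≤ 1 - L * δ := by
    have h1 : Real.exp (-2 * (L * δ)) * (1 + 2 * (L * δ)) ≤ 1 := by
      have h2 := Real.add_one_le_exp (2 * (L * δ))
      have h3 : Real.exp (-2 * (L * δ)) * Real.exp (2 * (L * δ)) = 1 := by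
        rw [← Real.exp_add]
        simp
      have h4 := mul_le_mul_of_nonneg_left h2 (Real.exp_pos (-2 * (L * δ))).le
      linarith
    have h5 : 0 < L * δ := by positivity
    have h6 : 1 ≤ (1 - L * δ) * (1 + 2 * (L * δ)) := by nlinarith
    exact le_of_mul_le_mul_right (h1.trans h6) (by linarith)
  -- Induction upwards from the product measure. It must cover all fields, since splitting at
  -- coupling `(j + 1) * δ` produces models with uncontrolled fields `k s`.
  have key : ∀ j : ℕ, j ≤ m → ∀ h : V → ℝ,
      Real.exp (-2 * (L * δ)) ^ j * Real.exp (-2 * β) ^ (d + 1) *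
        weightedVariance (isingWeight G Finset.univ (j * δ) h) f ≤
        percolationVariance G β (isingWeight G Finset.univ (j * δ) h) f := by
    intro j
    induction j with
    | zero =>
      intro _ h
      simpa using pow_mul_weightedVariance_le_of_product G hG hβ.le h f
    | succ j ih =>
      intro hj h
      have hjβ : ((j + 1 : ℕ) : ℝ) * δ ≤ β := by
        calc ((j + 1 : ℕ) : ℝ) * δ ≤ m * δ := by gcongr
          _ = β := by rw [hδ]; field_simp
      obtain ⟨c, hc, k, hmix, hvar⟩ := hstep δ hδpos hδle ((j + 1 : ℕ) * δ) (by positivity)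
        (tanh_strictMono.monotone hjβ) h f
      have hcoup : ((j + 1 : ℕ) : ℝ) * δ - δ = j * δ := by
        push_cast
        ring
      rw [hcoup] at hvar
      simp only [hcoup] at hmix
      have hV := weightedVariance_nonneg
        (fun σ => (isingWeight_pos G Finset.univ ((j + 1 : ℕ) * δ) h σ).le) f
      set C := Real.exp (-2 * (L * δ)) ^ j * Real.exp (-2 * β) ^ (d + 1) with hC
      calc _ = C * (Real.exp (-2 * (L * δ)) *
            weightedVariance (isingWeight G Finset.univ ((j + 1 : ℕ) * δ) h) f) := by
            rw [hC, pow_succ]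
            ring
        _ ≤ C * ((1 - L * δ) *
            weightedVariance (isingWeight G Finset.univ ((j + 1 : ℕ) * δ) h) f) := by gcongr
        _ ≤ C * ∑ s, c s * weightedVariance (isingWeight G Finset.univ (j * δ) (k s)) f := by gcongr
        _ = ∑ s, c s * (C * weightedVariance (isingWeight G Finset.univ (j * δ) (k s)) f) := by
          rw [Finset.mul_sum]
          exact Finset.sum_congr rfl fun s _ => mul_left_comm _ _ _
        _ ≤ ∑ s, c s * percolationVariance G β (isingWeight G Finset.univ (j * δ) (k s)) f :=
          Finset.sum_le_sum fun s _ =>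
            mul_le_mul_of_nonneg_left (ih (by omega) (k s)) (hc s).le
        _ ≤ _ := sum_percolationVariance_le G hβ.le _ hc
          (fun s σ => isingWeight_pos G Finset.univ (j * δ) (k s) σ) f
        _ = _ := by
          congr 1
          ext σ
          exact (hmix σ).symm
  have hmδ : (m : ℝ) * δ = β := by rw [hδ]; field_simp
  have hfin := key m le_rfl h
  rw [hmδ, ← Real.exp_nat_mul] at hfin
  convert hfin using 4
  rw [hL, ← hmδ]
  ring

end Percolation

/-! ### From a Poincaré inequality to eigenvalues -/

section SpectralGap

variable {Ω : Type*} [Fintype Ω] [DecidableEq Ω]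

theorem diagonal_mul_mul_diagonal_charpoly {D D' : Ω → ℝ} (h : ∀ x, D x * D' x = 1)
    (P : Matrix Ω Ω ℝ) :
    (Matrix.diagonal D * P * Matrix.diagonal D').charpoly = P.charpoly := by
  rw [Matrix.charpoly_mul_comm, ← mul_assoc, Matrix.diagonal_mul_diagonal]
  simp [mul_comm (D' _), h]

/-- A Poincaré inequality for a reversible stochastic matrix with nonnegative quadratic form bounds
its nontrivial eigenvalues. -/
theorem norm_le_of_mem_eigenvalueMultiset_erase {P : Matrix Ω Ω ℝ} {w : Ω → ℝ}
    (hw : ∀ x, 0 < w x) (hrev : ∀ x y, w x * P x y = w y * P y x) (hP : ∀ x, ∑ y, P x y = 1)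
    (hpos : ∀ f : Ω → ℝ, 0 ≤ ∑ x, w x * (f x * P.mulVec f x)) {c : ℝ} (hc : 0 < c)
    (hgap : ∀ f : Ω → ℝ, c * weightedVariance w f ≤
      ∑ x, w x * f x ^ 2 - ∑ x, w x * (f x * P.mulVec f x))
    {z : ℂ} (hz : z ∈ (eigenvalueMultiset P).erase 1) : ‖z‖ ≤ 1 - c := by
  -- Conjugation by the square root of the reversible weight makes `P` symmetric without changing
  -- its characteristic polynomial.
  set r : Ω → ℝ := fun x => √(w x) with hr
  have hr0 : ∀ x, 0 < r x := fun x => Real.sqrt_pos.2 (hw x)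
  have hrr : ∀ x, r x * r x = w x := fun x => Real.mul_self_sqrt (hw x).le
  set S := Matrix.diagonal r * P * Matrix.diagonal (fun x => (r x)⁻¹) with hS
  have hSapp : ∀ x y, S x y = r x * P x y * (r y)⁻¹ := fun x y => by
    rw [hS, Matrix.mul_diagonal, Matrix.diagonal_mul]
  have hSH : S.IsHermitian := by
    ext x y
    rw [Matrix.conjTranspose_apply, hSapp, hSapp, star_trivial]
    have h1 := hrev x y
    rw [← hrr, ← hrr] at h1
    have := (hr0 x).ne'
    have := (hr0 y).ne'
    field_simp
    linarith
  have hroots : eigenvalueMultiset P =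
      (Finset.univ.val.map fun j => ((hSH.eigenvalues j : ℝ) : ℂ)) := by
    have h1 : S.charpoly = P.charpoly :=
      diagonal_mul_mul_diagonal_charpoly (fun x => mul_inv_cancel₀ (hr0 x).ne') P
    rw [eigenvalueMultiset, Matrix.charpoly_map, ← h1, hSH.charpoly_eq, Polynomial.map_prod]
    simp only [Polynomial.map_sub, Polynomial.map_X, Polynomial.map_C]
    rw [Polynomial.roots_prod _ _ (Finset.prod_ne_zero_iff.2 fun j _ =>
      Polynomial.X_sub_C_ne_zero _)]
    simp
  set g : Ω → Ω → ℝ := fun j x => (r x)⁻¹ * hSH.eigenvectorBasis j x with hg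
  have heig : ∀ j, P.mulVec (g j) = fun x => hSH.eigenvalues j * g j x := by
    intro j
    ext x
    have h1 := congrFun (hSH.mulVec_eigenvectorBasis j) x
    simp only [Matrix.mulVec, dotProduct, hSapp, Pi.smul_apply, smul_eq_mul] at h1
    simp only [Matrix.mulVec, dotProduct, hg]
    rw [mul_left_comm, ← h1, Finset.mul_sum]
    refine Finset.sum_congr rfl fun y _ => ?_
    have := (hr0 x).ne'
    field_simp
  have horth : ∀ i j, ∑ x, w x * (g i x * g j x) = if i = j then 1 else 0 := by
    intro i j
    have h1 := orthonormal_iff_ite.1 hSH.eigenvectorBasis.orthonormal i j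
    rw [← h1, PiLp.inner_apply]
    refine Finset.sum_congr rfl fun x _ => ?_
    simp only [hg, ← hrr, RCLike.inner_apply, conj_trivial]
    have := (hr0 x).ne'
    field_simp
  have hnorm : ∀ j, ∑ x, w x * g j x ^ 2 = 1 := fun j => by
    simpa [pow_two] using horth j j
  have hform : ∀ j, ∑ x, w x * (g j x * P.mulVec (g j) x) = hSH.eigenvalues j := by
    intro j
    rw [heig]
    calc _ = hSH.eigenvalues j * ∑ x, w x * g j x ^ 2 := by
          rw [Finset.mul_sum]
          exact Finset.sum_congr rfl fun x _ => by ring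
      _ = _ := by rw [hnorm, mul_one]
  have hnonneg : ∀ j, 0 ≤ hSH.eigenvalues j := fun j => (hpos (g j)).trans_eq (hform j)
  have hmean : ∀ j, hSH.eigenvalues j * ∑ x, w x * g j x = ∑ x, w x * g j x := by
    intro j
    calc hSH.eigenvalues j * ∑ x, w x * g j x = ∑ x, w x * P.mulVec (g j) x := by
          rw [heig, Finset.mul_sum]
          exact Finset.sum_congr rfl fun x _ => by ring
      _ = ∑ y, (∑ x, w x * P x y) * g j y := by
        simp only [Matrix.mulVec, dotProduct, Finset.mul_sum, Finset.sum_mul]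
        rw [Finset.sum_comm]
        exact Finset.sum_congr rfl fun x _ => Finset.sum_congr rfl fun y _ => by ring
      _ = _ := by
        refine Finset.sum_congr rfl fun y _ => ?_
        rw [Finset.sum_congr rfl fun x _ => hrev x y, ← Finset.mul_sum, hP, mul_one]
  have hbound : ∀ j, ∑ x, w x * g j x = 0 → hSH.eigenvalues j ≤ 1 - c := by
    intro j hj
    have := hgap (g j)
    rw [weightedVariance, hj, hform, hnorm] at this
    norm_num at this
    linarith
  -- Which copy of `1` is erased matters. If some index `i` has eigenvalue `1`, that one is dropped:
  -- `hgap` forces its eigenvector to be constant, and the others are orthogonal to it. If there is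
  -- none, nothing is erased and `hmean` gives mean zero.
  have hfinal : ∃ j, z = ((hSH.eigenvalues j : ℝ) : ℂ) ∧ ∑ x, w x * g j x = 0 := by
    by_cases hone : ∃ i, hSH.eigenvalues i = 1
    · obtain ⟨i, hi⟩ := hone
      have herase : (eigenvalueMultiset P).erase 1 =
          ((Finset.univ.erase i).val.map fun j => ((hSH.eigenvalues j : ℝ) : ℂ)) := by
        rw [hroots, ← Finset.insert_erase (Finset.mem_univ i),
          Finset.insert_val_of_notMem (Finset.notMem_erase i _), Multiset.map_cons, hi]
        simp
      rw [herase] at hz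
      obtain ⟨j, hj, rfl⟩ := Multiset.mem_map.1 hz
      have hji : j ≠ i := Finset.ne_of_mem_erase hj
      refine ⟨j, rfl, ?_⟩
      have hvar : weightedVariance w (g i) = 0 := by
        have h1 := hgap (g i)
        rw [hform, hi, hnorm, sub_self] at h1
        have h2 := weightedVariance_nonneg (fun x => (hw x).le) (g i)
        nlinarith
      rw [weightedVariance_eq_sum, Finset.sum_eq_zero_iff_of_nonneg
        (fun x _ => mul_nonneg (hw x).le (sq_nonneg _))] at hvar
      set m := (∑ y, w y * g i y) / ∑ y, w y
      have hconst : ∀ x, g i x = m := fun x => by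
        have := hvar x (Finset.mem_univ x)
        have := (mul_eq_zero.1 this).resolve_left (hw x).ne'
        have := pow_eq_zero_iff (two_ne_zero) |>.1 this
        linarith
      have h0 := horth i j
      rw [if_neg hji.symm] at h0
      simp only [hconst] at h0
      have h1 : m * ∑ x, w x * g j x = 0 := by
        rw [← h0, Finset.mul_sum]
        exact Finset.sum_congr rfl fun x _ => by ring
      refine (mul_eq_zero.1 h1).resolve_left fun hm => ?_
      have := hnorm i
      simp [hconst, hm] at this
    · rw [hroots] at hz
      obtain ⟨j, _, rfl⟩ := Multiset.mem_map.1 (Multiset.mem_of_mem_erase hz)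
      refine ⟨j, rfl, ?_⟩
      have hne : hSH.eigenvalues j - 1 ≠ 0 := sub_ne_zero.2 fun h => hone ⟨j, h⟩
      have := hmean j
      exact (mul_eq_zero.1 (by linarith : (hSH.eigenvalues j - 1) * ∑ x, w x * g j x =
        0)).resolve_left hne
  obtain ⟨j, rfl, hj⟩ := hfinal
  rw [Complex.norm_real, Real.norm_of_nonneg (hnonneg j)]
  exact hbound j hj

/-- The lower bound `1` needs only `0 ≤ secondEigenvalueModulus P`, true also for an empty set of
moduli, where `sSup` is `0`. -/
theorem relaxationTime_bounds {P : Matrix Ω Ω ℝ} {c : ℝ} (hc : 0 < c) (hc1 : c ≤ 1)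
    (h : ∀ z ∈ (eigenvalueMultiset P).erase 1, ‖z‖ ≤ 1 - c) :
    0 < absSpectralGap P ∧ 1 ≤ relaxationTime P ∧ relaxationTime P ≤ c⁻¹ := by
  have h1 : secondEigenvalueModulus P ≤ 1 - c := by
    refine Real.sSup_le ?_ (by linarith)
    rintro _ ⟨z, hz, rfl⟩
    exact h z hz
  have h0 : 0 ≤ secondEigenvalueModulus P := by
    refine Real.sSup_nonneg ?_
    rintro _ ⟨z, _, rfl⟩
    exact norm_nonneg z
  have hgap : c ≤ absSpectralGap P := by
    unfold absSpectralGap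
    linarith
  have hgap1 : absSpectralGap P ≤ 1 := by
    unfold absSpectralGap
    linarith
  exact ⟨hc.trans_le hgap, (one_le_inv₀ (hc.trans_le hgap)).2 hgap1, inv_anti₀ hc hgap⟩

end SpectralGap

/-! ### Edwards–Sokal coupling and the Swendsen–Wang Dirichlet form -/

section SwendsenWang

variable {V : Type*} [Fintype V] [DecidableEq V] (G : SimpleGraph V) [DecidableRel G.Adj]

theorem subset_agreeingEdges_iff {F : Finset (Sym2 V)} (hF : ∀ e ∈ F, e ∈ G.edgeSet)
    (τ : IsingConfig V) : F ⊆ agreeingEdges G τ ↔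
      ∃ s : (SimpleGraph.fromEdgeSet (F : Set (Sym2 V))).ConnectedComponent → ℤˣ,
        ∀ v, τ v = s ((SimpleGraph.fromEdgeSet (F : Set (Sym2 V))).connectedComponentMk v) := by
  constructor
  · intro h
    have hadj : ∀ u v, (SimpleGraph.fromEdgeSet (F : Set (Sym2 V))).Reachable u v → τ u = τ v := by
      rintro u v ⟨p⟩
      induction p with
      | nil => rfl
      | cons hadj _ ih =>
        refine Eq.trans ?_ ih
        rw [SimpleGraph.fromEdgeSet_adj] at hadj
        exact ((mem_agreeingEdges G).1 (h hadj.1)).2 _ (Sym2.mem_mk_left _ _) _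
          (Sym2.mem_mk_right _ _)
    exact ⟨fun c => c.lift τ fun u v p _ => hadj u v ⟨p⟩, fun v => rfl⟩
  · rintro ⟨s, hs⟩ e he
    refine (mem_agreeingEdges G).2 ⟨hF e he, fun v hv w hw => ?_⟩
    rcases eq_or_ne v w with rfl | hvw
    · rfl
    rw [hs, hs]
    congr 1
    refine SimpleGraph.ConnectedComponent.sound (SimpleGraph.Adj.reachable ?_)
    rw [SimpleGraph.fromEdgeSet_adj]
    have : e = s(v, w) := (Sym2.mem_and_mem_iff hvw).1 ⟨hv, hw⟩
    exact ⟨this ▸ he, hvw⟩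

theorem sum_half_pow_card {X : Type*} {_ : Fintype X} {_ : Fintype (X → ℤˣ)} :
    ∑ _s : X → ℤˣ, (1 / 2 : ℝ) ^ Fintype.card X = 1 := by
  have hcard : Fintype.card (X → ℤˣ) = 2 ^ Fintype.card X := by
    rw [← Nat.card_eq_fintype_card, Nat.card_fun, Nat.card_eq_fintype_card,
      Nat.card_eq_fintype_card, Fintype.card_units_int]
  rw [Finset.sum_const, Finset.card_univ, hcard, nsmul_eq_mul]
  simp

theorem sum_recolorProb (F : Finset (Sym2 V)) : ∑ τ, recolorProb F τ = 1 := by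
  unfold recolorProb
  rw [Finset.sum_comm]
  have : ∀ s : (SimpleGraph.fromEdgeSet (F : Set (Sym2 V))).ConnectedComponent → ℤˣ,
      ∀ c : ℝ, (∑ τ : IsingConfig V, if ∀ v, τ v =
        s ((SimpleGraph.fromEdgeSet (F : Set (Sym2 V))).connectedComponentMk v) then c else 0) =
        c := by
    intro s c
    simp only [← funext_iff (f := (_ : IsingConfig V))
      (g := fun v => s ((SimpleGraph.fromEdgeSet (F : Set (Sym2 V))).connectedComponentMk v))]
    simp
  simp only [this]
  exact sum_half_pow_card

theorem recolorProb_eq_ite (F : Finset (Sym2 V)) (τ : IsingConfig V)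
    [Decidable (∃ s : (SimpleGraph.fromEdgeSet (F : Set (Sym2 V))).ConnectedComponent → ℤˣ,
      ∀ v, τ v = s ((SimpleGraph.fromEdgeSet (F : Set (Sym2 V))).connectedComponentMk v))] :
    recolorProb F τ = if ∃ s : (SimpleGraph.fromEdgeSet (F : Set (Sym2 V))).ConnectedComponent → ℤˣ,
        ∀ v, τ v = s ((SimpleGraph.fromEdgeSet (F : Set (Sym2 V))).connectedComponentMk v)
      then (1 / 2 : ℝ) ^ Nat.card
        (SimpleGraph.fromEdgeSet (F : Set (Sym2 V))).ConnectedComponent else 0 := by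
  unfold recolorProb
  split_ifs with h
  · obtain ⟨s, hs⟩ := h
    rw [Finset.sum_eq_single s]
    · rw [if_pos hs]
      congr 1
      convert Nat.card_eq_fintype_card.symm
    · intro s' _ hne
      refine if_neg fun hs' => hne (funext fun c => ?_)
      induction c using SimpleGraph.ConnectedComponent.ind with
      | h v => rw [← hs, ← hs']
    · simp
  · exact Finset.sum_eq_zero fun s _ => if_neg fun hs => h ⟨s, hs⟩

/-- The indicator function of the configurations that are constant along the edges in `F`. -/
noncomputable def agreeIndicator (F : Finset (Sym2 V)) (σ : IsingConfig V) : ℝ :=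
  if F ⊆ agreeingEdges G σ then 1 else 0

/-- Independent uniform spins on the components of `F` give the uniform law on configurations
agreeing along `F`. This form makes the symmetry of the dynamics visible without counting
components. -/
theorem recolorProb_eq_div {F : Finset (Sym2 V)} (hF : F ⊆ G.edgeFinset) (τ : IsingConfig V) :
    recolorProb F τ = agreeIndicator G F τ / ∑ σ, agreeIndicator G F σ := by
  classical
  have hF' : ∀ e ∈ F, e ∈ G.edgeSet := fun e he => SimpleGraph.mem_edgeFinset.1 (hF he)
  have h1 : ∀ τ, recolorProb F τ = agreeIndicator G F τ * (1 / 2 : ℝ) ^ Nat.card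
      (SimpleGraph.fromEdgeSet (F : Set (Sym2 V))).ConnectedComponent := fun τ => by
    rw [recolorProb_eq_ite, agreeIndicator]
    simp only [subset_agreeingEdges_iff G hF', ite_mul, one_mul, zero_mul]
  have h2 := sum_recolorProb F
  simp only [h1, ← Finset.sum_mul] at h2
  rw [h1, eq_div_iff (left_ne_zero_of_mul_eq_one h2), mul_assoc, mul_comm (_ ^ _), h2, mul_one]

/-- Ordered pairs count each edge twice, with sign `1` if it agrees and `-1` otherwise. -/
theorem sum_agreement_eq (σ : IsingConfig V) :
    ∑ u, ∑ v, (if G.Adj u v then spin (σ u) * spin (σ v) else 0) =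
      4 * ((agreeingEdges G σ).card : ℝ) - 2 * (G.edgeFinset.card : ℝ) := by
  let H : SimpleGraph V :=
    { Adj := fun u v => G.Adj u v ∧ σ u = σ v
      symm := ⟨fun u v h => ⟨h.1.symm, h.2.symm⟩⟩
      loopless := ⟨fun u h => G.irrefl h.1⟩ }
  have : DecidableRel H.Adj := fun u v => inferInstanceAs (Decidable (G.Adj u v ∧ σ u = σ v))
  have hH : H.edgeFinset = agreeingEdges G σ := by
    ext e
    rw [SimpleGraph.mem_edgeFinset, mem_agreeingEdges]
    induction e using Sym2.ind with
    | _ u v =>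
      rw [SimpleGraph.mem_edgeSet, SimpleGraph.mem_edgeSet]
      refine and_congr_right fun _ => ?_
      constructor
      · intro h a ha b hb
        rcases Sym2.mem_iff.1 ha with rfl | rfl <;> rcases Sym2.mem_iff.1 hb with rfl | rfl <;>
          first | rfl | exact h | exact h.symm
      · intro h
        exact h u (Sym2.mem_mk_left u v) v (Sym2.mem_mk_right u v)
  have hdeg : ∀ (K : SimpleGraph V) [DecidableRel K.Adj],
      ∑ u, ∑ v, (if K.Adj u v then (1 : ℝ) else 0) = 2 * (K.edgeFinset.card : ℝ) := by
    intro K _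
    have := K.sum_degrees_eq_twice_card_edges
    rw [← Nat.cast_inj (R := ℝ)] at this
    push_cast at this
    rw [← this]
    refine Finset.sum_congr rfl fun u _ => ?_
    rw [Finset.sum_boole, ← SimpleGraph.neighborFinset_eq_filter,
      SimpleGraph.card_neighborFinset_eq_degree]
  have hspin : ∀ u v, (if G.Adj u v then spin (σ u) * spin (σ v) else 0) =
      2 * (if H.Adj u v then (1 : ℝ) else 0) - if G.Adj u v then (1 : ℝ) else 0 := by
    intro u v
    by_cases h : G.Adj u v
    · have hiff : H.Adj u v ↔ σ u = σ v := ⟨fun h' => h'.2, fun h' => ⟨h, h'⟩⟩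
      simp only [h, hiff, if_true]
      rcases Int.units_eq_one_or (σ u) with h1 | h1 <;>
        rcases Int.units_eq_one_or (σ v) with h2 | h2 <;> simp [h1, h2] <;> norm_num
    · have hneg : ¬ H.Adj u v := fun h' => h h'.1
      simp [h, hneg]
  simp only [hspin, Finset.sum_sub_distrib, ← Finset.mul_sum, hdeg, hH]
  ring

/-- The Edwards–Sokal cancellation: the Ising weight carries `exp (2β)` per agreeing edge and the
kernel `exp (-2β)` per deleted one, so the number of agreeing edges drops out. -/
theorem isingWeight_mul_percolationKernel {β : ℝ} (hβ : 0 ≤ β) (F : Finset (Sym2 V)) :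
    ∃ a : ℝ, 0 ≤ a ∧ ∀ σ, isingWeight G Finset.univ β (fun _ => 0) σ * percolationKernel G β F σ =
      a * agreeIndicator G F σ := by
  have hq : Real.exp (-2 * β) ≤ 1 := by
    rw [← Real.exp_zero]
    exact Real.exp_le_exp.2 (by linarith)
  refine ⟨(1 - Real.exp (-2 * β)) ^ F.card *
    Real.exp (2 * β * F.card - β * G.edgeFinset.card),
    mul_nonneg (pow_nonneg (by linarith) _) (Real.exp_pos _).le, fun σ => ?_⟩
  unfold percolationKernel agreeIndicator
  split_ifs with h
  · rw [isingWeight, sum_agreement_eq, percolationProb, mul_one, mul_left_comm, ← Real.exp_nat_mul,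
      ← Real.exp_add, Nat.cast_sub (Finset.card_le_card h)]
    congr 2
    simp only [zero_mul, Finset.sum_const_zero]
    ring
  · simp

theorem sum_percolationKernel (β : ℝ) (σ : IsingConfig V) :
    ∑ F ∈ G.edgeFinset.powerset, percolationKernel G β F σ = 1 := by
  have h1 : ∑ F ∈ (agreeingEdges G σ).powerset, percolationProb G β σ F = 1 := by
    unfold percolationProb
    rw [Finset.sum_pow_mul_eq_add_pow]
    simp
  rw [← h1]
  symm
  refine Finset.sum_subset_zero_on_sdiff
    (Finset.powerset_mono.2 (agreeingEdges_subset G σ)) (fun F hF => ?_) fun F hF => ?_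
  · rw [Finset.mem_sdiff, Finset.mem_powerset, Finset.mem_powerset] at hF
    exact if_neg hF.2
  · exact (if_pos (Finset.mem_powerset.1 hF)).symm

theorem swendsenWang_apply (β : ℝ) (σ τ : IsingConfig V) :
    swendsenWang G β σ τ =
      ∑ F ∈ G.edgeFinset.powerset, percolationKernel G β F σ * recolorProb F τ := by
  rw [swendsenWang, Matrix.of_apply]
  refine Finset.sum_subset_zero_on_sdiff
    (Finset.powerset_mono.2 (agreeingEdges_subset G σ)) (fun F hF => ?_) fun F hF => ?_
  · rw [Finset.mem_sdiff, Finset.mem_powerset, Finset.mem_powerset] at hF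
    rw [percolationKernel, if_neg hF.2, zero_mul]
  · rw [percolationKernel, if_pos (Finset.mem_powerset.1 hF)]

theorem sum_swendsenWang (β : ℝ) (σ : IsingConfig V) : ∑ τ, swendsenWang G β σ τ = 1 := by
  simp only [swendsenWang_apply]
  rw [Finset.sum_comm]
  simp only [← Finset.mul_sum, sum_recolorProb, mul_one]
  exact sum_percolationKernel G β σ

/-- The absolute spectral gap of the Swendsen-Wang dynamics is bounded below by a Poincaré constant
for the percolation step. -/
theorem norm_eigenvalue_le_of_percolationVariance {β : ℝ} (hβ : 0 ≤ β) {c : ℝ} (hc : 0 < c)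
    (hgap : ∀ f, c * weightedVariance (isingWeight G Finset.univ β fun _ => 0) f ≤
      percolationVariance G β (isingWeight G Finset.univ β fun _ => 0) f)
    {z : ℂ} (hz : z ∈ (eigenvalueMultiset (swendsenWang G β)).erase 1) : ‖z‖ ≤ 1 - c := by
  set w := isingWeight G Finset.univ β fun _ => 0 with hw
  choose a ha0 ha using isingWeight_mul_percolationKernel G hβ
  rw [← hw] at ha
  have hentry : ∀ σ τ, w σ * swendsenWang G β σ τ = ∑ F ∈ G.edgeFinset.powerset,
      a F * (agreeIndicator G F σ * agreeIndicator G F τ) / ∑ ξ, agreeIndicator G F ξ := by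
    intro σ τ
    rw [swendsenWang_apply, Finset.mul_sum]
    refine Finset.sum_congr rfl fun F hF => ?_
    rw [recolorProb_eq_div G (Finset.mem_powerset.1 hF), ← mul_assoc, ha]
    ring
  -- Each summand is a square times a nonnegative number, hence positivity. Subtracted from the
  -- second moment, it leaves the conditional variance given `F`.
  have hquad : ∀ f : IsingConfig V → ℝ,
      ∑ σ, w σ * (f σ * (swendsenWang G β).mulVec f σ) = ∑ F ∈ G.edgeFinset.powerset,
        a F * ((∑ σ, agreeIndicator G F σ * f σ) ^ 2 / ∑ ξ, agreeIndicator G F ξ) := by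
    intro f
    have h1 : ∀ σ, w σ * (f σ * (swendsenWang G β).mulVec f σ) = ∑ τ, ∑ F ∈ G.edgeFinset.powerset,
        (agreeIndicator G F σ * f σ) * (agreeIndicator G F τ * f τ) *
          (a F / ∑ ξ, agreeIndicator G F ξ) := by
      intro σ
      rw [Matrix.mulVec, dotProduct, Finset.mul_sum, Finset.mul_sum]
      refine Finset.sum_congr rfl fun τ _ => ?_
      have : w σ * (f σ * (swendsenWang G β σ τ * f τ)) =
          (w σ * swendsenWang G β σ τ) * (f σ * f τ) := by ring
      rw [this, hentry, Finset.sum_mul]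
      exact Finset.sum_congr rfl fun F _ => by ring
    simp only [h1]
    rw [Finset.sum_congr rfl fun σ _ => Finset.sum_comm, Finset.sum_comm]
    refine Finset.sum_congr rfl fun F _ => ?_
    simp only [← Finset.sum_mul]
    rw [← Finset.sum_mul_sum]
    ring
  refine norm_le_of_mem_eigenvalueMultiset_erase (w := w) (isingWeight_pos G _ _ _) (fun σ τ => ?_)
    (sum_swendsenWang G β) (fun f => ?_) hc (fun f => ?_) hz
  · rw [hentry, hentry]
    exact Finset.sum_congr rfl fun F _ => by ring
  · rw [hquad]
    refine Finset.sum_nonneg fun F _ => mul_nonneg (ha0 F) (div_nonneg (sq_nonneg _)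
      (Finset.sum_nonneg fun ξ _ => ?_))
    unfold agreeIndicator
    split_ifs <;> norm_num
  · rw [hquad]
    refine (hgap f).trans (le_of_eq ?_)
    have h1 : ∑ σ, w σ * f σ ^ 2 = ∑ F ∈ G.edgeFinset.powerset,
        a F * ∑ σ, agreeIndicator G F σ * f σ ^ 2 := by
      simp only [Finset.mul_sum, ← mul_assoc, ← ha]
      rw [Finset.sum_comm]
      refine Finset.sum_congr rfl fun σ _ => ?_
      rw [← Finset.sum_mul, ← Finset.mul_sum, sum_percolationKernel, mul_one]
    rw [h1, ← Finset.sum_sub_distrib, percolationVariance]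
    refine Finset.sum_congr rfl fun F _ => ?_
    simp only [ha]
    rw [weightedVariance_smul, weightedVariance, mul_sub]

end SwendsenWang

/-! ### Uniform bounds on the relaxation time -/

theorem theorem1 (d : ℕ) (hd : 3 ≤ d) (βc : ℝ) (hβc : ((d : ℝ) - 1) * Real.tanh βc = 1)
    (β : ℝ) (hβ_pos : 0 < β) (hβ : β < βc) :
    ∃ c C : ℝ, 0 < c ∧
      ∀ (V : Type*) [Fintype V] [DecidableEq V] [Nonempty V]
        (G : SimpleGraph V) [DecidableRel G.Adj], G.maxDegree ≤ d →
        0 < absSpectralGap (swendsenWang G β) ∧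
          c ≤ relaxationTime (swendsenWang G β) ∧
          relaxationTime (swendsenWang G β) ≤ C := by
  -- `k = d - 1` is the branching number of the tree, in which the influence bounds are phrased.
  obtain ⟨k, rfl⟩ : ∃ k, d = k + 1 := ⟨d - 1, by omega⟩
  have hk : (0 : ℝ) < k := by
    have : 0 < k := by omega
    exact_mod_cast this
  have ht : k * Real.tanh β < 1 := by
    have h1 := mul_lt_mul_of_pos_left (tanh_strictMono hβ) hk
    push_cast at hβc
    linarith
  have ht0 : 0 ≤ Real.tanh β := by simpa using tanh_strictMono.monotone hβ_pos.le
  have hA : 0 < 1 - k * Real.tanh β := by linarith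
  set c := Real.exp (-8 * ((k + 1) * (1 + (k + 1) * Real.tanh β / (1 - k * Real.tanh β)) + 1) * β) *
    Real.exp (-2 * β) ^ (k + 1) with hc
  have hc0 : 0 < c := by positivity
  have hc1 : c ≤ 1 := by
    refine mul_le_one₀ (Real.exp_le_one_iff.2 ?_) (by positivity)
      (pow_le_one₀ (Real.exp_pos _).le (Real.exp_le_one_iff.2 (by linarith)))
    have : 0 ≤ ((k + 1) * (1 + (k + 1) * Real.tanh β / (1 - k * Real.tanh β)) + 1) * β := by
      positivity
    linarith
  refine ⟨1, c⁻¹, one_pos, fun V _ _ _ G _ hG => ?_⟩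
  exact relaxationTime_bounds hc0 hc1 fun z hz =>
    norm_eigenvalue_le_of_percolationVariance G hβ_pos.le hc0
      (exp_mul_weightedVariance_le_percolationVariance G
        (fun v => (G.degree_le_maxDegree v).trans hG) hβ_pos ht _) hz
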